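/- Let $\mathbb{F}$ be an algebraically closed field. **Definitions.** A (unital) Hamming space is a Boolean algebra $H$, regarded as a commutative ring with $1$ and $x^2=x$, together with a rank function $r:H\to[0,1]$ such that $r(a)=0\iff a=0$; $r(a)=1\iff a=1$; and $r(a+b)=r(a)+r(b)$ whenever $ab=0$. Isomorphisms are rank-preserving ring isomorphisms, and a subspace is a unital Boolean subalgebra with the restricted rank. The standard Hamming space is $H_n=(\mathbb{Z}/2\mathbb{Z})^n$, $n\ge 1$, with $r(x_1,\dots,x_n)=\frac1n(x_1+\dots+x_n)$, $x_i\in\{0,1\}$. A Hamming space $S$ is locally standard if every finite subset of $S$ lies in a subspace isomorphic to some $H_m$; its Steinitz number $\mathbf{st}(S)$ is the least common multiple (as a formal product $\prod_p p^{r_p}$ over the primes, $r_p\in\mathbb{N}\cup\{0,\infty\}$) of all $n\ge1$ such that $S$ has a subspace isomorphic to $H_n$. A locally matrix algebra is a unital associative $\mathbb{F}$-algebra $A$ in which every finite subset lies in a subalgebra $A'\ni 1$ with $A'\cong M_n(\mathbb{F})$ for some $n\ge1$; $\mathbf{st}(A)$ is the least common multiple of all $n\ge 1$ such that $A$ has a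 subalgebra $A'\ni1$ with $A'\cong M_n(\mathbb{F})$. The relative rank of $a\in A$ is $r(a)=\frac1n\operatorname{rank}_{M_n(\mathbb{F})}(a)$ for any subalgebra $A'\ni 1,a$ with $A'\cong M_n(\mathbb{F})$; it does not depend on the choice of $A'$. For a commutative subalgebra $C\ni 1$ of $A$, $E(C)$ is the Hamming space of all idempotents of $C$ with product $ef$, sum $e+f-2ef$ and the relative rank. A subalgebra $H\subseteq A$ is a Cartan subalgebra if there are a decomposition $A=\bigotimes_{i=1}^\infty A_i$ with $A_i\cong M_{n_i}(\mathbb{F})$, $n_i\ge 1$, and subalgebras $C_i\subseteq A_i$ with $C_i\cong\mathbb{F}^{n_i}$ (as algebras) such that $H=\bigotimes_{i=1}^\infty C_i$. Countable means finite or countably infinite, and countable dimensional means of dimension at most $\aleph_0$. **Theorem.** (1) For every countable locally standard Hamming space $S$ there are a countable dimensional locally matrix algebra $A$ over $\mathbb{F}$ and a Cartan subalgebra $H$ of $A$ such that $S\cong E(H)$ as Hamming spaces and $\mathbf{st}(S)=\mathbf{st}(A)$. (2) Let $A_1,A_2$ be countable dimensional locally matrix algebras over $\mathbb{F}$ with Cartan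 subalgebras $H_1\subseteq A_1$, $H_2\subseteq A_2$. Then $E(H_1)$ and $E(H_2)$ are isomorphic as Hamming spaces if and only if $A_1\cong A_2$ as $\mathbb{F}$-algebras. -/

import Mathlib

universe u v w₁ w₂

/-! ### Steinitz numbers -/

/-- A Steinitz number: a formal product of `p ^ r p` over all primes `p`, with `r p ≤ ∞`. -/
def SteinitzNumber : Type := Nat.Primes → ℕ∞

/-- The least common multiple of a set of positive integers, as a Steinitz number: the exponent
of `p` is the supremum of the `p`-adic valuations of the elements of the set. -/
noncomputable def steinitzLcm (D : Set ℕ) : SteinitzNumber :=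
  fun p => ⨆ n ∈ D, ((n.factorization (p : ℕ) : ℕ) : ℕ∞)

/-! ### Hamming spaces -/

/-- A (unital) Hamming space: a Boolean algebra (given as a Boolean ring) with a rank function. -/
class HammingSpace (H : Type*) [BooleanRing H] where
  rank : H → ℝ
  rank_mem : ∀ a, rank a ∈ Set.Icc (0 : ℝ) 1
  rank_eq_zero_iff : ∀ a, rank a = 0 ↔ a = 0
  rank_eq_one_iff : ∀ a, rank a = 1 ↔ a = 1
  rank_add : ∀ a b, a * b = 0 → rank (a + b) = rank a + rank b

/-- An isomorphism of Hamming spaces. -/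
structure HammingIso (H K : Type*) [BooleanRing H] [BooleanRing K] [HammingSpace H]
    [HammingSpace K] extends H ≃+* K where
  rank_map : ∀ a, HammingSpace.rank (toFun a) = HammingSpace.rank a

instance instBooleanRingStd (n : ℕ) : BooleanRing (Fin n → ZMod 2) where
  toRing := inferInstance
  isIdempotentElem a := by
    funext i
    change a i * a i = a i
    generalize a i = x
    revert x
    decide

/-- The standard Hamming space `H_n`, `n ≥ 1`, with `rank x = (x_1 + ... + x_n) / n`. -/
noncomputable instance instHammingSpaceStd (n : ℕ) [NeZero n] :
    HammingSpace (Fin n → ZMod 2) where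
  rank x := (∑ i, ((x i).val : ℝ)) / n
  rank_mem x := by
    have hn : (0 : ℝ) < n := by exact_mod_cast Nat.pos_of_ne_zero (NeZero.ne n)
    refine ⟨by positivity, ?_⟩
    rw [div_le_one hn]
    calc (∑ i, ((x i).val : ℝ)) ≤ ∑ _i : Fin n, (1 : ℝ) :=
          Finset.sum_le_sum fun i _ => by
            have := ZMod.val_lt (x i)
            exact_mod_cast Nat.lt_succ_iff.mp this
      _ = n := by simp
  rank_eq_zero_iff x := by
    have hn : (n : ℝ) ≠ 0 := by exact_mod_cast NeZero.ne n
    rw [div_eq_zero_iff, or_iff_left hn, Finset.sum_eq_zero_iff_of_nonneg (fun _ _ => by positivity)]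
    simp only [Finset.mem_univ, forall_true_left, Nat.cast_eq_zero, ZMod.val_eq_zero, funext_iff,
      Pi.zero_apply]
  rank_eq_one_iff x := by
    have hn : (n : ℝ) ≠ 0 := by exact_mod_cast NeZero.ne n
    have key : ∀ y : ZMod 2, ((y.val : ℝ) ≤ 1) ∧ ((y.val : ℝ) = 1 ↔ y = 1) := by
      intro y
      refine ⟨by exact_mod_cast Nat.lt_succ_iff.mp (ZMod.val_lt y), ?_⟩
      rw [Nat.cast_eq_one]
      revert y
      decide
    have h1 : (n : ℝ) = ∑ _i : Fin n, (1 : ℝ) := by simp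
    rw [div_eq_one_iff_eq hn]
    conv_lhs => rw [h1]
    rw [Finset.sum_eq_sum_iff_of_le (fun i _ => (key (x i)).1)]
    simp only [Finset.mem_univ, forall_true_left, (key _).2, funext_iff, Pi.one_apply]
  rank_add x y hxy := by
    rw [← add_div, ← Finset.sum_add_distrib]
    congr 1
    refine Finset.sum_congr rfl fun i _ => ?_
    have h : x i * y i = 0 := congrFun hxy i
    change (((x i + y i).val : ℕ) : ℝ) = _
    rw [← Nat.cast_add, Nat.cast_inj]
    revert h
    generalize x i = u
    generalize y i = v
    revert u v
    decide

instance instBooleanRingSubring {H : Type*} [BooleanRing H] (T : Subring H) : BooleanRing T where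
  toRing := inferInstance
  isIdempotentElem a := Subtype.ext (BooleanRing.isIdempotentElem (a : H))

/-- A subspace of a Hamming space (a unital Boolean subalgebra with the restricted rank). -/
instance instHammingSpaceSubring {H : Type*} [BooleanRing H] [HammingSpace H] (T : Subring H) :
    HammingSpace T where
  rank a := HammingSpace.rank (a : H)
  rank_mem a := HammingSpace.rank_mem (a : H)
  rank_eq_zero_iff a := (HammingSpace.rank_eq_zero_iff (a : H)).trans
    ⟨fun h => Subtype.ext h, fun h => congrArg Subtype.val h⟩
  rank_eq_one_iff a := (HammingSpace.rank_eq_one_iff (a : H)).trans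
    ⟨fun h => Subtype.ext h, fun h => congrArg Subtype.val h⟩
  rank_add a b h := HammingSpace.rank_add (a : H) (b : H) (by exact_mod_cast congrArg Subtype.val h)

/-- A Hamming space is locally standard if each finite set of elements lies in a subspace
isomorphic to some standard Hamming space `H_m`, `m ≥ 1`. -/
def IsLocallyStandard (H : Type*) [BooleanRing H] [HammingSpace H] : Prop :=
  ∀ s : Finset H, ∃ T : Subring H, (s : Set H) ⊆ T ∧
    ∃ (m : ℕ) (_ : NeZero m), Nonempty (HammingIso T (Fin m → ZMod 2))

/-- The Steinitz number `st(H)` of a (locally standard) Hamming space. -/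
noncomputable def hammingSt (H : Type*) [BooleanRing H] [HammingSpace H] : SteinitzNumber :=
  steinitzLcm {n : ℕ | ∃ _ : NeZero n, ∃ T : Subring H,
    Nonempty (HammingIso T (Fin n → ZMod 2))}

/-! ### Locally matrix algebras -/

section Algebras

variable (F : Type*) [Field F] {A : Type*} [Ring A] [Algebra F A]

/-- Unital locally matrix algebras: each finite set of elements lies in a unital subalgebra
isomorphic to some matrix algebra `M_n(F)`, `n ≥ 1`. -/
class IsLocallyMatrixAlgebra (A : Type*) [Ring A] [Algebra F A] : Prop where
  exists_subalgebra : ∀ s : Finset A, ∃ B : Subalgebra F A, (s : Set A) ⊆ B ∧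
    ∃ n : ℕ, 0 < n ∧ Nonempty (B ≃ₐ[F] Matrix (Fin n) (Fin n) F)

/-- The Steinitz number `st(A)` of a (unital locally matrix) algebra. -/
noncomputable def algebraSt (A : Type*) [Ring A] [Algebra F A] : SteinitzNumber :=
  steinitzLcm {n : ℕ | 0 < n ∧ ∃ B : Subalgebra F A,
    Nonempty (B ≃ₐ[F] Matrix (Fin n) (Fin n) F)}

/-- `q` is the relative rank of `a` computed in some unital subalgebra `B ≅ M_n(F)`
containing `a`. -/
def HasRelRank (a : A) (q : ℝ) : Prop :=
  ∃ (B : Subalgebra F A) (ha : a ∈ B) (n : ℕ) (_ : 0 < n) (e : B ≃ₐ[F] Matrix (Fin n) (Fin n) F),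
    q = ((e ⟨a, ha⟩).rank : ℝ) / n

theorem exists_hasRelRank [IsLocallyMatrixAlgebra F A] (a : A) : ∃ q, HasRelRank F a q := by
  obtain ⟨B, hB, n, hn, ⟨e⟩⟩ := IsLocallyMatrixAlgebra.exists_subalgebra (F := F) {a}
  exact ⟨_, B, hB (by simp), n, hn, e, rfl⟩

/-- The relative rank of an element of a locally matrix algebra. By `HasRelRank.unique` below,
it does not depend on the chosen matrix subalgebra. -/
noncomputable def relRank [IsLocallyMatrixAlgebra F A] (a : A) : ℝ :=
  Classical.choose (exists_hasRelRank F a)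

theorem hasRelRank_relRank [IsLocallyMatrixAlgebra F A] (a : A) :
    HasRelRank F a (relRank F a) :=
  Classical.choose_spec (exists_hasRelRank F a)

variable {F}

theorem matrix_rank_eq_zero {k : ℕ} (p : Matrix (Fin k) (Fin k) F) : p.rank = 0 ↔ p = 0 := by
  unfold Matrix.rank
  rw [Submodule.finrank_eq_zero, LinearMap.range_eq_bot]
  exact ⟨fun h => Matrix.mulVec_injective (funext fun v => by
    simpa using LinearMap.congr_fun h v), fun h => by rw [h]; exact Matrix.mulVecLin_zero⟩

theorem rank_add_of_orthogonal_idempotent {k : ℕ} (p q : Matrix (Fin k) (Fin k) F)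
    (hp : p * p = p) (hq : q * q = q) (hpq : p * q = 0) (hqp : q * p = 0) :
    (p + q).rank = p.rank + q.rank := by
  have hsub : (p + q).rank ≤ p.rank + q.rank := by
    unfold Matrix.rank
    refine le_trans (Submodule.finrank_mono ?_) (Submodule.finrank_add_le_finrank_add_finrank
      (LinearMap.range p.mulVecLin) (LinearMap.range q.mulVecLin))
    rintro _ ⟨x, rfl⟩
    rw [Matrix.mulVecLin_add, LinearMap.add_apply]
    exact Submodule.add_mem_sup ⟨x, rfl⟩ ⟨x, rfl⟩
  refine le_antisymm hsub ?_
  have hdisj : Disjoint (LinearMap.range p.mulVecLin) (LinearMap.range q.mulVecLin) := by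
    rw [Submodule.disjoint_def]
    rintro _ ⟨x, rfl⟩ ⟨y, hy⟩
    simp only [Matrix.mulVecLin_apply] at hy ⊢
    calc p.mulVec x = p.mulVec (p.mulVec x) := by rw [Matrix.mulVec_mulVec, hp]
      _ = p.mulVec (q.mulVec y) := by rw [hy]
      _ = 0 := by rw [Matrix.mulVec_mulVec, hpq, Matrix.zero_mulVec]
  have hle : LinearMap.range p.mulVecLin ⊔ LinearMap.range q.mulVecLin ≤
      LinearMap.range (p + q).mulVecLin := by
    refine sup_le ?_ ?_
    · rintro _ ⟨x, rfl⟩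
      exact ⟨p.mulVec x, by simp [hp, hqp]⟩
    · rintro _ ⟨x, rfl⟩
      exact ⟨q.mulVec x, by simp [hq, hpq]⟩
  have h := Submodule.finrank_sup_add_finrank_inf_eq (LinearMap.range p.mulVecLin)
    (LinearMap.range q.mulVecLin)
  rw [hdisj.eq_bot, finrank_bot, add_zero] at h
  unfold Matrix.rank
  rw [← h]
  exact Submodule.finrank_mono hle

theorem rank_algHom_matrix {n k : ℕ}
    (φ : Matrix (Fin n) (Fin n) F →ₐ[F] Matrix (Fin k) (Fin k) F)
    (M : Matrix (Fin n) (Fin n) F) : n * (φ M).rank = k * M.rank := by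
  classical
  let E : Fin n → Matrix (Fin n) (Fin n) F := fun i => Matrix.single i i 1
  have hEE : ∀ i j, E i * E j = if i = j then E i else 0 := by
    intro i j
    split_ifs with h
    · subst h; simp [E]
    · simp [E, h]
  -- all diagonal units have images of the same rank
  have hconst : ∀ i j, (φ (E i)).rank ≤ (φ (E j)).rank := by
    intro i j
    have : E i = Matrix.single i j 1 * E j * Matrix.single j i 1 := by simp [E]
    rw [this, map_mul, map_mul]
    exact (Matrix.rank_mul_le_left _ _).trans (Matrix.rank_mul_le_right _ _)
  have hsum : ∀ s : Finset (Fin n), (φ (∑ i ∈ s, E i)).rank = ∑ i ∈ s, (φ (E i)).rank := by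
    intro s
    induction s using Finset.induction_on with
    | empty => simp
    | insert a s ha ih =>
      rw [Finset.sum_insert ha, Finset.sum_insert ha, map_add, ← ih]
      have h0 : ∀ i ∈ s, a ≠ i := fun i hi h => ha (h ▸ hi)
      have h1 : E a * ∑ i ∈ s, E i = 0 := by
        rw [Finset.mul_sum]
        exact Finset.sum_eq_zero fun i hi => by rw [hEE, if_neg (h0 i hi)]
      have h2 : (∑ i ∈ s, E i) * E a = 0 := by
        rw [Finset.sum_mul]
        exact Finset.sum_eq_zero fun i hi => by rw [hEE, if_neg (h0 i hi).symm]
      have h3 : (∑ i ∈ s, E i) * ∑ i ∈ s, E i = ∑ i ∈ s, E i := by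
        rw [Finset.sum_mul_sum]
        refine Finset.sum_congr rfl fun i hi => ?_
        simp [hEE, hi]
      apply rank_add_of_orthogonal_idempotent
      · rw [← map_mul, hEE, if_pos rfl]
      · rw [← map_mul, h3]
      · rw [← map_mul, h1, map_zero]
      · rw [← map_mul, h2, map_zero]
  have hone : ∑ i, E i = 1 := by
    ext i j
    simp [E, Matrix.sum_apply, Matrix.single_apply, Matrix.one_apply, ite_and]
  obtain ⟨L, L', D, hM⟩ := Matrix.Pivot.exists_list_transvec_mul_diagonal_mul_list_transvec M
  have hL : ∀ L : List (Matrix.TransvectionStruct (Fin n) F),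
      IsUnit ((L.map Matrix.TransvectionStruct.toMatrix).prod) := by
    intro L
    rw [Matrix.isUnit_iff_isUnit_det, Matrix.TransvectionStruct.det_toMatrix_prod]
    exact isUnit_one
  let s : Finset (Fin n) := Finset.univ.filter fun i => D i ≠ 0
  let D' : Fin n → F := fun i => if D i = 0 then 1 else D i
  have hD' : IsUnit (Matrix.diagonal D') := by
    rw [Matrix.isUnit_iff_isUnit_det, Matrix.det_diagonal, isUnit_iff_ne_zero,
      Finset.prod_ne_zero_iff]
    intro i _
    by_cases h : D i = 0 <;> simp [D', h]
  have hs : ∑ i ∈ s, E i = Matrix.diagonal fun i => if D i = 0 then (0 : F) else 1 := by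
    ext i j
    simp only [E, Matrix.sum_apply, Matrix.single_apply, Matrix.diagonal_apply, ite_and]
    by_cases hij : i = j
    · subst hij
      by_cases h : D i = 0 <;> simp [s, h]
    · simp only [hij, if_false]
      refine Finset.sum_eq_zero fun x _ => ?_
      by_cases hx : x = i
      · subst hx; simp [hij]
      · simp [hx]
  have hD : Matrix.diagonal D = Matrix.diagonal D' * ∑ i ∈ s, E i := by
    rw [hs, Matrix.diagonal_mul_diagonal]
    congr 1
    funext i
    by_cases h : D i = 0 <;> simp [D', h]
  have key : ∀ (m : ℕ) (ψ : Matrix (Fin n) (Fin n) F →ₐ[F] Matrix (Fin m) (Fin m) F),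
      (ψ M).rank = (ψ (∑ i ∈ s, E i)).rank := by
    intro m ψ
    rw [hM, hD, map_mul, map_mul, map_mul,
      Matrix.rank_mul_eq_left_of_isUnit_det _ _
        ((Matrix.isUnit_iff_isUnit_det _).1 ((hL L').map ψ)),
      Matrix.rank_mul_eq_right_of_isUnit_det _ _
        ((Matrix.isUnit_iff_isUnit_det _).1 ((hL L).map ψ)),
      Matrix.rank_mul_eq_right_of_isUnit_det _ _
        ((Matrix.isUnit_iff_isUnit_det _).1 (hD'.map ψ))]
  have hMr : M.rank = s.card := by
    have h := key n (AlgHom.id F _)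
    simp only [AlgHom.id_apply] at h
    rw [h, hs, Matrix.rank_diagonal, Fintype.card_subtype]
    congr 1
    ext i
    by_cases h : D i = 0 <;> simp [s, h]
  rw [key k φ, hMr, hsum]
  rcases Nat.eq_zero_or_pos n with hn | hn
  · subst hn
    simp [Finset.eq_empty_of_isEmpty s]
  · have hc : ∀ i, (φ (E i)).rank = (φ (E ⟨0, hn⟩)).rank := fun i =>
      le_antisymm (hconst _ _) (hconst _ _)
    have hk : k = n * (φ (E ⟨0, hn⟩)).rank := by
      have h := hsum Finset.univ
      rw [hone, map_one, Matrix.rank_one, Finset.sum_congr rfl fun i _ => hc i] at h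
      simpa using h
    rw [Finset.sum_congr rfl fun i _ => hc i, Finset.sum_const, smul_eq_mul]
    conv_rhs => rw [hk]
    ring

/-- The relative rank does not depend on the choice of the matrix subalgebra. -/
theorem HasRelRank.unique [IsLocallyMatrixAlgebra F A] {a : A} {q₁ q₂ : ℝ}
    (h₁ : HasRelRank F a q₁) (h₂ : HasRelRank F a q₂) : q₁ = q₂ := by
  classical
  obtain ⟨B₁, ha₁, n₁, hn₁, e₁, rfl⟩ := h₁
  obtain ⟨B₂, ha₂, n₂, hn₂, e₂, rfl⟩ := h₂
  have fin₁ : Module.Finite F B₁ := Module.Finite.equiv e₁.symm.toLinearEquiv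
  have fin₂ : Module.Finite F B₂ := Module.Finite.equiv e₂.symm.toLinearEquiv
  obtain ⟨s₁, hs₁⟩ : (Subalgebra.toSubmodule B₁).FG := Module.Finite.iff_fg.1 fin₁
  obtain ⟨s₂, hs₂⟩ : (Subalgebra.toSubmodule B₂).FG := Module.Finite.iff_fg.1 fin₂
  obtain ⟨B, hB, k, hk, ⟨e⟩⟩ := IsLocallyMatrixAlgebra.exists_subalgebra (F := F) (s₁ ∪ s₂)
  rw [Finset.coe_union, Set.union_subset_iff] at hB
  have le₁ : B₁ ≤ B := by
    rw [← Subalgebra.toSubmodule.le_iff_le, ← hs₁, Submodule.span_le]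
    exact hB.1
  have le₂ : B₂ ≤ B := by
    rw [← Subalgebra.toSubmodule.le_iff_le, ← hs₂, Submodule.span_le]
    exact hB.2
  have aux : ∀ (B' : Subalgebra F A) (n : ℕ) (_ : 0 < n) (e' : B' ≃ₐ[F] Matrix (Fin n) (Fin n) F)
      (hle : B' ≤ B) (ha : a ∈ B'), ((e' ⟨a, ha⟩).rank : ℝ) / n = ((e ⟨a, hle ha⟩).rank : ℝ) / k := by
    intro B' n hn e' hle ha
    have h := rank_algHom_matrix
      ((e.toAlgHom.comp (Subalgebra.inclusion hle)).comp e'.symm.toAlgHom) (e' ⟨a, ha⟩)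
    have h' : ((e.toAlgHom.comp (Subalgebra.inclusion hle)).comp e'.symm.toAlgHom) (e' ⟨a, ha⟩)
        = e ⟨a, hle ha⟩ := by
      simp [Subalgebra.inclusion]
    rw [h'] at h
    have hn' : (n : ℝ) ≠ 0 := by exact_mod_cast hn.ne'
    have hk' : (k : ℝ) ≠ 0 := by exact_mod_cast hk.ne'
    rw [div_eq_div_iff hn' hk']
    have h2 : (n : ℝ) * ((e ⟨a, hle ha⟩).rank : ℝ) = k * ((e' ⟨a, ha⟩).rank : ℝ) := by
      exact_mod_cast h
    linarith
  rw [aux B₁ n₁ hn₁ e₁ le₁ ha₁, aux B₂ n₂ hn₂ e₂ le₂ ha₂]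

theorem relRank_eq [IsLocallyMatrixAlgebra F A] {B : Subalgebra F A} {a : A} (ha : a ∈ B) {n : ℕ}
    (hn : 0 < n) (e : B ≃ₐ[F] Matrix (Fin n) (Fin n) F) :
    relRank F a = ((e ⟨a, ha⟩).rank : ℝ) / n :=
  (hasRelRank_relRank F a).unique ⟨B, ha, n, hn, e, rfl⟩

/-! ### The Hamming space of idempotents of a commutative subalgebra -/

/-- The set `E(C)` of all idempotents of a subalgebra `C`. -/
def Idempotents (C : Subalgebra F A) : Type _ := {e : A // e ∈ C ∧ e * e = e}

namespace Idempotents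

variable {C : Subalgebra F A}

theorem ext' {e f : Idempotents C} (h : e.1 = f.1) : e = f := Subtype.ext h

variable [hC : IsMulCommutative C]

theorem comm (e f : Idempotents C) : e.1 * f.1 = f.1 * e.1 :=
  congrArg Subtype.val (hC.is_comm.comm (⟨e.1, e.2.1⟩ : C) ⟨f.1, f.2.1⟩)

set_option linter.unusedSectionVars false

instance : Zero (Idempotents C) := ⟨⟨0, C.zero_mem, by simp⟩⟩
instance : One (Idempotents C) := ⟨⟨1, C.one_mem, by simp⟩⟩
instance : Neg (Idempotents C) := ⟨fun e => e⟩

theorem mul_idem (e f : Idempotents C) : (e.1 * f.1) * (e.1 * f.1) = e.1 * f.1 := by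
  rw [mul_assoc, ← mul_assoc f.1, comm f e, mul_assoc, f.2.2, ← mul_assoc, e.2.2]

/-- The Boolean product is `e f`. -/
instance : Mul (Idempotents C) := ⟨fun e f => ⟨e.1 * f.1, C.mul_mem e.2.1 f.2.1, mul_idem e f⟩⟩

/-- The Boolean sum is `e + f - 2 e f`. -/
instance : Add (Idempotents C) := ⟨fun e f => ⟨e.1 + f.1 - 2 * (e.1 * f.1), by
    refine C.sub_mem (C.add_mem e.2.1 f.2.1) ?_
    rw [two_mul]
    exact C.add_mem (C.mul_mem e.2.1 f.2.1) (C.mul_mem e.2.1 f.2.1), by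
    have h1 := e.2.2
    have h2 := f.2.2
    have h3 := mul_idem e f
    have h4 : f.1 * e.1 = e.1 * f.1 := comm f e
    have h5 : e.1 * (e.1 * f.1) = e.1 * f.1 := by rw [← mul_assoc, h1]
    have h6 : f.1 * (e.1 * f.1) = e.1 * f.1 := by rw [← mul_assoc, h4, mul_assoc, h2]
    have h7 : (e.1 * f.1) * e.1 = e.1 * f.1 := by rw [mul_assoc, h4, h5]
    have h8 : (e.1 * f.1) * f.1 = e.1 * f.1 := by rw [mul_assoc, h2]
    simp only [two_mul, sub_mul, mul_sub, add_mul, mul_add, h1, h2, h3, h4, h5, h6, h7, h8]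
    abel⟩⟩

@[simp] theorem val_zero : (0 : Idempotents C).1 = 0 := rfl
@[simp] theorem val_one : (1 : Idempotents C).1 = 1 := rfl
@[simp] theorem val_mul (e f : Idempotents C) : (e * f).1 = e.1 * f.1 := rfl
@[simp] theorem val_add (e f : Idempotents C) : (e + f).1 = e.1 + f.1 - 2 * (e.1 * f.1) := rfl

/-- The Boolean algebra `E(C)`. -/
instance : BooleanRing (Idempotents C) where
  add_assoc e f g := ext' (by
    simp only [val_add, two_mul, sub_mul, mul_sub, add_mul, mul_add, mul_assoc]
    abel)
  zero_add e := ext' (by simp)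
  add_zero e := ext' (by simp)
  neg_add_cancel e := ext' (by
    change e.1 + e.1 - 2 * (e.1 * e.1) = 0
    rw [e.2.2, two_mul, sub_self])
  add_comm e f := ext' (by rw [val_add, val_add, comm e f, add_comm e.1])
  mul_assoc e f g := ext' (mul_assoc _ _ _)
  one_mul e := ext' (one_mul _)
  mul_one e := ext' (mul_one _)
  left_distrib e f g := ext' (by
    have h : e.1 * f.1 * (e.1 * g.1) = e.1 * (f.1 * g.1) := by
      rw [mul_assoc, ← mul_assoc f.1, comm f e, mul_assoc, ← mul_assoc, e.2.2]
    simp only [val_add, val_mul, two_mul, mul_sub, mul_add, h])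
  right_distrib e f g := ext' (by
    have h : e.1 * g.1 * (f.1 * g.1) = e.1 * (f.1 * g.1) := by
      rw [mul_assoc, ← mul_assoc g.1, comm g f, mul_assoc, g.2.2]
    simp only [val_add, val_mul, two_mul, sub_mul, add_mul, h, mul_assoc])
  zero_mul e := ext' (zero_mul _)
  mul_zero e := ext' (mul_zero _)
  isIdempotentElem e := ext' e.2.2
  nsmul := nsmulRec
  zsmul := zsmulRec

/-- `E(C)` with the relative rank is a Hamming space. -/
noncomputable instance [IsLocallyMatrixAlgebra F A] : HammingSpace (Idempotents C) where
  rank e := relRank F e.1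
  rank_mem e := by
    obtain ⟨B, ha, n, hn, φ, h⟩ := hasRelRank_relRank F e.1
    rw [h]
    have hn' : (0 : ℝ) < n := by exact_mod_cast hn
    refine ⟨by positivity, (div_le_one hn').2 ?_⟩
    exact_mod_cast (Matrix.rank_le_width _)
  rank_eq_zero_iff e := by
    obtain ⟨B, ha, n, hn, φ, h⟩ := hasRelRank_relRank F e.1
    have hn' : (n : ℝ) ≠ 0 := by exact_mod_cast hn.ne'
    rw [h, div_eq_zero_iff, or_iff_left hn', Nat.cast_eq_zero, matrix_rank_eq_zero,
      EmbeddingLike.map_eq_zero_iff]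
    exact ⟨fun h => ext' (congrArg (Subtype.val : B → A) h),
      fun h => Subtype.ext (congrArg (Subtype.val : Idempotents C → A) h)⟩
  rank_eq_one_iff e := by
    obtain ⟨B, ha, n, hn, φ, h⟩ := hasRelRank_relRank F e.1
    have hn' : (n : ℝ) ≠ 0 := by exact_mod_cast hn.ne'
    have hφ : φ ⟨e.1, ha⟩ * φ ⟨e.1, ha⟩ = φ ⟨e.1, ha⟩ := by
      rw [← map_mul]
      exact congrArg φ (Subtype.ext e.2.2)
    have h1 : (φ ⟨e.1, ha⟩).rank = n ↔ φ ⟨e.1, ha⟩ = 1 := by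
      constructor
      · intro hr
        have hadd := rank_add_of_orthogonal_idempotent (φ ⟨e.1, ha⟩) (1 - φ ⟨e.1, ha⟩) hφ
          (by simp [sub_mul, mul_sub, hφ]) (by simp [mul_sub, hφ]) (by simp [sub_mul, hφ])
        rw [add_sub_cancel, Matrix.rank_one, Fintype.card_fin, hr] at hadd
        have h0 : (1 - φ ⟨e.1, ha⟩).rank = 0 := by omega
        rw [matrix_rank_eq_zero, sub_eq_zero] at h0
        exact h0.symm
      · intro hr
        rw [hr, Matrix.rank_one, Fintype.card_fin]
    rw [h, div_eq_one_iff_eq hn', Nat.cast_inj, h1, EmbeddingLike.map_eq_one_iff]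
    exact ⟨fun h => ext' (congrArg (Subtype.val : B → A) h),
      fun h => Subtype.ext (congrArg (Subtype.val : Idempotents C → A) h)⟩
  rank_add e f hef := by
    classical
    obtain ⟨B, hB, n, hn, ⟨φ⟩⟩ :=
      IsLocallyMatrixAlgebra.exists_subalgebra (F := F) {e.1, f.1}
    have he : e.1 ∈ B := hB (by simp)
    have hf : f.1 ∈ B := hB (by simp)
    have h0 : e.1 * f.1 = 0 := congrArg Subtype.val hef
    have h0' : f.1 * e.1 = 0 := by rw [comm, h0]
    have hadd : (e + f).1 = e.1 + f.1 := by rw [val_add, h0, mul_zero, sub_zero]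
    rw [hadd, relRank_eq (B.add_mem he hf) hn φ, relRank_eq he hn φ, relRank_eq hf hn φ, ← add_div]
    have hsum : φ ⟨e.1 + f.1, B.add_mem he hf⟩ = φ ⟨e.1, he⟩ + φ ⟨f.1, hf⟩ := by
      rw [← map_add]
      rfl
    rw [hsum, rank_add_of_orthogonal_idempotent, Nat.cast_add]
    · rw [← map_mul]; exact congrArg φ (Subtype.ext e.2.2)
    · rw [← map_mul]; exact congrArg φ (Subtype.ext f.2.2)
    · rw [← map_mul, ← map_zero φ]; exact congrArg φ (Subtype.ext h0)
    · rw [← map_mul, ← map_zero φ]; exact congrArg φ (Subtype.ext h0')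

end Idempotents

/-! ### Cartan subalgebras -/

/-- `A` is the (internal) infinite tensor product of its unital subalgebras `B 0, B 1, ...`: they
commute pairwise, they generate `A`, and for each `n` the multiplication map
`B 0 ⊗ ... ⊗ B (n - 1) → A` is injective. -/
structure IsInternalTensorProduct (B : ℕ → Subalgebra F A) : Prop where
  commute : ∀ i j, i ≠ j → ∀ x ∈ B i, ∀ y ∈ B j, x * y = y * x
  iSup_eq_top : ⨆ i, B i = ⊤
  injective : ∀ n : ℕ, Function.Injective
    (PiTensorProduct.lift ((MultilinearMap.mkPiAlgebraFin F n A).compLinearMap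
      fun i : Fin n => (B (i : ℕ)).val.toLinearMap))

/-- `H ⊆ A` is a Cartan subalgebra: there are a decomposition of `A` as an infinite tensor product
of matrix algebras `B i ≅ M_{n_i}(F)`, `n_i ≥ 1`, and subalgebras `C i ⊆ B i` with `C i ≅ F^{n_i}`
such that `H` is the tensor product of the `C i`, that is, the subalgebra they generate. -/
class IsCartanSubalgebra (H : Subalgebra F A) : Prop where
  exists_decomposition : ∃ (n : ℕ → ℕ) (B C : ℕ → Subalgebra F A),
    IsInternalTensorProduct B ∧
    (∀ i, 0 < n i ∧ Nonempty (B i ≃ₐ[F] Matrix (Fin (n i)) (Fin (n i)) F)) ∧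
    (∀ i, C i ≤ B i ∧ Nonempty (C i ≃ₐ[F] (Fin (n i) → F))) ∧
    H = ⨆ i, C i

instance IsCartanSubalgebra.isMulCommutative (H : Subalgebra F A) [hH : IsCartanSubalgebra H] :
    IsMulCommutative H := by
  obtain ⟨n, B, C, hB, -, hC, rfl⟩ := hH.exists_decomposition
  have hadj : (⨆ i, C i) = Algebra.adjoin F (⋃ i, (C i : Set A)) := by
    refine le_antisymm (iSup_le fun i x hx =>
      Algebra.subset_adjoin (Set.mem_iUnion.2 ⟨i, hx⟩)) (Algebra.adjoin_le ?_)
    exact Set.iUnion_subset fun i => le_iSup C i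
  rw [hadj]
  refine Algebra.isMulCommutative_adjoin F ?_
  intro x hx y hy
  obtain ⟨i, hx⟩ := Set.mem_iUnion.1 hx
  obtain ⟨j, hy⟩ := Set.mem_iUnion.1 hy
  by_cases hij : i = j
  · subst hij
    obtain ⟨e⟩ := (hC i).2
    have h : (⟨x, hx⟩ : C i) * ⟨y, hy⟩ = ⟨y, hy⟩ * ⟨x, hx⟩ := by
      apply e.injective
      rw [map_mul, map_mul, mul_comm]
    exact congrArg Subtype.val h
  · exact hB.commute i j hij x ((hC i).1 hx) y ((hC j).1 hy)

end Algebras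

/-! ### Back and forth between unions of standard objects -/

/-! Both kinds of object are classified by their Steinitz number, and a Cartan subalgebra has the
same Steinitz number as its ambient algebra.

The classifications share one back-and-forth argument. The algebras M_n(F) and the spaces H_n both
form systems in which a map of size n into size m > 0 exists iff n divides m, and any two such maps
differ by a map of the target to itself: a conjugation for matrices, a permutation of coordinates
for Hamming spaces. A countable directed union of such objects is then determined by the set of
sizes that embed in it. This set is directed and closed under divisors, so the Steinitz number
determines it. The abstract statement is `exists_equiv_of_steinitzLcm_eq`; the two instances are
`nonempty_algEquiv_of_algebraSt_eq` (Glimm's theorem) and `nonempty_hammingIso_of_hammingSt_eq`.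

For the comparison, let A be the tensor product of the B_i and H that of the C_i. The first k
factors generate a matrix algebra of size N_k = n_0 ... n_{k-1} in A, and in H the span of N_k
orthogonal idempotents of relative rank 1/N_k, whose idempotents form a copy of H_{N_k}. So A and
E(H) are exhausted by standard objects of the same sizes (`isLocallyStandard_idempotents`). This
gives (2).

For (1), it remains to find an algebra with a Cartan subalgebra and prescribed Steinitz number. The
set of sizes is replaced by the partial products of a sequence q, and matrices of size q_k act on
functions of a sequence through its k-th entry; these actions commute and generate the algebra
(`exists_cartan_of_sequence`). -/

/-- Homomorphisms between standard objects `E n`, governed by divisibility and unique up to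
conjugation. -/
structure IsStandardSystem {E : ℕ → Type*} (Hom : ∀ n m, Set (E n → E m)) : Prop where
  comp : ∀ {n m k : ℕ} {a : E n → E m} {b : E m → E k}, a ∈ Hom n m → b ∈ Hom m k →
    b ∘ a ∈ Hom n k
  dvd : ∀ {n m : ℕ} {a : E n → E m}, 0 < m → a ∈ Hom n m → n ∣ m
  nonempty : ∀ {n m : ℕ}, 0 < m → n ∣ m → (Hom n m).Nonempty
  conj : ∀ {n m : ℕ} {a b : E n → E m}, 0 < m → a ∈ Hom n m → b ∈ Hom n m →
    ∃ u ∈ Hom m m, u ∘ b = a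

/-- `K` is a countable directed union of images of standard objects. -/
structure IsUnionOfStandard {E : ℕ → Type*} (Hom : ∀ n m, Set (E n → E m)) {K : Type*}
    (Emb : ∀ n, Set (E n → K)) : Prop where
  pos : ∀ {n : ℕ} {φ : E n → K}, φ ∈ Emb n → 0 < n
  comp : ∀ {n m : ℕ} {a : E n → E m} {φ : E m → K}, 0 < n → a ∈ Hom n m → φ ∈ Emb m →
    φ ∘ a ∈ Emb n
  injective : ∀ {n : ℕ} {φ : E n → K}, φ ∈ Emb n → Function.Injective φ
  directed : ∀ {n m : ℕ} {φ : E n → K} {ψ : E m → K}, φ ∈ Emb n → ψ ∈ Emb m →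
    ∃ (k : ℕ) (χ : E k → K) (a : E n → E k) (b : E m → E k),
      χ ∈ Emb k ∧ a ∈ Hom n k ∧ b ∈ Hom m k ∧ χ ∘ a = φ ∧ χ ∘ b = ψ
  exists_seq : ∃ (N : ℕ → ℕ) (φ : ∀ k, E (N k) → K), (∀ k, φ k ∈ Emb (N k)) ∧
    ∀ x, ∃ k, x ∈ Set.range (φ k)

/-- The sizes of the standard subobjects. -/
def embSizes {E : ℕ → Type*} {K : Type*} (Emb : ∀ n, Set (E n → K)) : Set ℕ :=
  {n | (Emb n).Nonempty}

/-! ### Steinitz numbers and divisibility. -/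

theorem le_steinitzLcm {D : Set ℕ} {n : ℕ} (hn : n ∈ D) (p : Nat.Primes) :
    ((n.factorization (p : ℕ) : ℕ) : ℕ∞) ≤ steinitzLcm D p :=
  le_iSup₂ (f := fun n (_ : n ∈ D) => ((n.factorization (p : ℕ) : ℕ) : ℕ∞)) n hn

/-- Only cofinality under divisibility matters. The multiple must be nonzero: every number divides
0, whose factorization is zero by convention. -/
theorem steinitzLcm_le_of_dvd {D D' : Set ℕ} (h : ∀ n ∈ D, ∃ m ∈ D', m ≠ 0 ∧ n ∣ m)
    (p : Nat.Primes) : steinitzLcm D p ≤ steinitzLcm D' p := by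
  refine iSup₂_le fun n hn => ?_
  obtain ⟨m, hm, hm0, hnm⟩ := h n hn
  refine le_trans ?_ (le_steinitzLcm hm p)
  have hn0 : n ≠ 0 := fun h => hm0 (by simpa [h] using hnm)
  exact_mod_cast (Nat.factorization_le_iff_dvd hn0 hm0).2 hnm p

theorem steinitzLcm_eq_of_dvd {D D' : Set ℕ} (h : ∀ n ∈ D, ∃ m ∈ D', m ≠ 0 ∧ n ∣ m)
    (h' : ∀ n ∈ D', ∃ m ∈ D, m ≠ 0 ∧ n ∣ m) : steinitzLcm D = steinitzLcm D' :=
  funext fun p => le_antisymm (steinitzLcm_le_of_dvd h p) (steinitzLcm_le_of_dvd h' p)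

section BackAndForth

variable {E : ℕ → Type*} {Hom : ∀ n m, Set (E n → E m)} {K L : Type*}
  {EmbK : ∀ n, Set (E n → K)} {EmbL : ∀ n, Set (E n → L)}

theorem IsUnionOfStandard.mem_embSizes_of_dvd (hE : IsStandardSystem Hom)
    (hK : IsUnionOfStandard Hom EmbK) {n m : ℕ} (hm : m ∈ embSizes EmbK) (hnm : n ∣ m) :
    n ∈ embSizes EmbK := by
  obtain ⟨φ, hφ⟩ := hm
  obtain ⟨a, ha⟩ := hE.nonempty (hK.pos hφ) hnm
  exact ⟨_, hK.comp (Nat.pos_of_dvd_of_pos hnm (hK.pos hφ)) ha hφ⟩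

theorem IsUnionOfStandard.exists_dvd_dvd (hE : IsStandardSystem Hom)
    (hK : IsUnionOfStandard Hom EmbK) {n m : ℕ} (hn : n ∈ embSizes EmbK)
    (hm : m ∈ embSizes EmbK) : ∃ k ∈ embSizes EmbK, n ∣ k ∧ m ∣ k := by
  obtain ⟨φ, hφ⟩ := hn
  obtain ⟨ψ, hψ⟩ := hm
  obtain ⟨k, χ, a, b, hχ, ha, hb, -, -⟩ := hK.directed hφ hψ
  exact ⟨k, ⟨χ, hχ⟩, hE.dvd (hK.pos hχ) ha, hE.dvd (hK.pos hχ) hb⟩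

theorem IsUnionOfStandard.one_mem_embSizes (hE : IsStandardSystem Hom)
    (hK : IsUnionOfStandard Hom EmbK) : 1 ∈ embSizes EmbK := by
  obtain ⟨N, φ, hφ, -⟩ := hK.exists_seq
  exact hK.mem_embSizes_of_dvd hE ⟨φ 0, hφ 0⟩ (one_dvd _)

/-- The Steinitz number recovers the exact set of sizes. Each prime power in m already divides some
size; directedness collects the finitely many primes of m into one size k, and m is a size because
it divides k. -/
theorem IsUnionOfStandard.mem_embSizes_of_le (hE : IsStandardSystem Hom)
    (hK : IsUnionOfStandard Hom EmbK) {m : ℕ} (hm0 : m ≠ 0)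
    (hm : ∀ p : Nat.Primes, ((m.factorization (p : ℕ) : ℕ) : ℕ∞) ≤ steinitzLcm (embSizes EmbK) p) :
    m ∈ embSizes EmbK := by
  have key : ∀ s : Finset ℕ, ∃ k ∈ embSizes EmbK, ∀ p ∈ s, p.Prime →
      m.factorization p ≤ k.factorization p := by
    intro s
    induction s using Finset.induction_on with
    | empty => exact ⟨1, hK.one_mem_embSizes hE, by simp⟩
    | insert q s hq ih =>
      obtain ⟨k, hk, hks⟩ := ih
      obtain ⟨l, hl, hlq⟩ : ∃ l ∈ embSizes EmbK, q.Prime →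
          m.factorization q ≤ l.factorization q := by
        by_cases hqp : q.Prime
        swap
        · exact ⟨k, hk, fun h => absurd h hqp⟩
        rcases Nat.eq_zero_or_pos (m.factorization q) with h0 | h0
        · exact ⟨k, hk, fun _ => by simp [h0]⟩
        -- Subtracting one gives a strict inequality with the supremum, so some size beats it even
        -- when the supremum is infinite and not attained.
        · have h1 : ((m.factorization q - 1 : ℕ) : ℕ∞) < steinitzLcm (embSizes EmbK) ⟨q, hqp⟩ :=
            lt_of_lt_of_le (Nat.cast_lt.2 (Nat.sub_lt h0 one_pos)) (hm ⟨q, hqp⟩)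
          unfold steinitzLcm at h1
          simp only [lt_iSup_iff] at h1
          obtain ⟨l, hl, hlt⟩ := h1
          refine ⟨l, hl, fun _ => ?_⟩
          have : m.factorization q - 1 < l.factorization q := by exact_mod_cast hlt
          omega
      obtain ⟨r, hr, hkr, hlr⟩ := hK.exists_dvd_dvd hE hk hl
      have pos : ∀ {n}, n ∈ embSizes EmbK → n ≠ 0 := fun ⟨φ, hφ⟩ => (hK.pos hφ).ne'
      refine ⟨r, hr, fun p hp hpp => ?_⟩
      rcases Finset.mem_insert.1 hp with rfl | hp
      · exact (hlq hpp).trans ((Nat.factorization_le_iff_dvd (pos hl) (pos hr)).2 hlr p)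
      · exact (hks p hp hpp).trans ((Nat.factorization_le_iff_dvd (pos hk) (pos hr)).2 hkr p)
  obtain ⟨k, hk, hmk⟩ := key m.primeFactors
  refine hK.mem_embSizes_of_dvd hE hk ?_
  obtain ⟨φ, hφ⟩ := hk
  rw [← Nat.factorization_le_iff_dvd hm0 (hK.pos hφ).ne']
  intro p
  by_cases hp : p ∈ m.primeFactors
  · exact hmk p hp (Nat.prime_of_mem_primeFactors hp)
  · have : m.factorization p = 0 := by
      rwa [← Finsupp.notMem_support_iff, Nat.support_factorization]
    rw [this]; exact Nat.zero_le _

theorem embSizes_subset_of_steinitzLcm_eq (hE : IsStandardSystem Hom)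
    (hK : IsUnionOfStandard Hom EmbK) (hL : IsUnionOfStandard Hom EmbL)
    (h : steinitzLcm (embSizes EmbK) = steinitzLcm (embSizes EmbL)) :
    embSizes EmbK ⊆ embSizes EmbL := by
  intro m hm
  refine hL.mem_embSizes_of_le hE ?_ fun p => h ▸ le_steinitzLcm hm p
  obtain ⟨φ, hφ⟩ := hm
  exact (hK.pos hφ).ne'

/-- One half-step of the back and forth: φ is enlarged to absorb χ, and ψ is enlarged along with it
to the same size. -/
theorem IsUnionOfStandard.exists_extension (hE : IsStandardSystem Hom)
    (hK : IsUnionOfStandard Hom EmbK) (hL : IsUnionOfStandard Hom EmbL)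
    (h : embSizes EmbK ⊆ embSizes EmbL)
    {n m : ℕ} {φ : E n → K} {ψ : E n → L} {χ : E m → K} (hφ : φ ∈ EmbK n) (hψ : ψ ∈ EmbL n)
    (hχ : χ ∈ EmbK m) :
    ∃ (k : ℕ) (φ' : E k → K) (ψ' : E k → L) (j : E n → E k), φ' ∈ EmbK k ∧ ψ' ∈ EmbL k ∧
      φ' ∘ j = φ ∧ ψ' ∘ j = ψ ∧ Set.range χ ⊆ Set.range φ' := by
  obtain ⟨k, φ', a, b, hφ', ha, hb, rfl, rfl⟩ := hK.directed hφ hχ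
  obtain ⟨ψ₁, hψ₁⟩ := h ⟨φ', hφ'⟩
  obtain ⟨l, ω, c, d, hω, hc, hd, rfl, rfl⟩ := hL.directed hψ hψ₁
  -- The embedding ψ₁ was chosen without regard to ψ, so `d ∘ a` and `c` need not agree; conjugating
  -- inside `E l` makes them agree.
  obtain ⟨u, hu, hua⟩ := hE.conj (hL.pos hω) hc (hE.comp ha hd)
  refine ⟨k, φ', ω ∘ (u ∘ d), a, hφ', hL.comp (hK.pos hφ') (hE.comp hd hu) hω, rfl, ?_,
    Set.range_comp_subset_range b φ'⟩
  rw [← hua]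
  rfl

/-- The conclusion puts any two points in one standard piece on which `f` turns one embedding into
another; this suffices to transport binary operations, scalars and ranks. -/
theorem exists_equiv_of_steinitzLcm_eq (hE : IsStandardSystem Hom)
    (hK : IsUnionOfStandard Hom EmbK) (hL : IsUnionOfStandard Hom EmbL)
    (h : steinitzLcm (embSizes EmbK) = steinitzLcm (embSizes EmbL)) :
    ∃ f : K ≃ L, ∀ x y, ∃ (n : ℕ) (φ : E n → K) (ψ : E n → L), φ ∈ EmbK n ∧ ψ ∈ EmbL n ∧
      f ∘ φ = ψ ∧ x ∈ Set.range φ ∧ y ∈ Set.range φ := by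
  have hKL := embSizes_subset_of_steinitzLcm_eq hE hK hL h
  have hLK := embSizes_subset_of_steinitzLcm_eq hE hL hK h.symm
  obtain ⟨N, α, hα, hαK⟩ := hK.exists_seq
  obtain ⟨M, β, hβ, hβL⟩ := hL.exists_seq
  let P := Σ n, {φ : E n → K // φ ∈ EmbK n} × {ψ : E n → L // ψ ∈ EmbL n}
  let R : P → P → Prop := fun p q => ∃ j : E p.1 → E q.1,
    q.2.1.1 ∘ j = p.2.1.1 ∧ q.2.2.1 ∘ j = p.2.2.1
  have Rrefl : ∀ p, R p p := fun p => ⟨id, rfl, rfl⟩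
  have Rtrans : ∀ p q r, R p q → R q r → R p r := by
    rintro p q r ⟨j, h1, h2⟩ ⟨j', h3, h4⟩
    exact ⟨j' ∘ j, by rw [← Function.comp_assoc, h3, h1], by rw [← Function.comp_assoc, h4, h2]⟩
  have step : ∀ (k : ℕ) (p : P), ∃ q : P, R p q ∧ Set.range (α k) ⊆ Set.range q.2.1.1 ∧
      Set.range (β k) ⊆ Set.range q.2.2.1 := by
    rintro k ⟨n, ⟨φ, hφ⟩, ⟨ψ, hψ⟩⟩
    obtain ⟨m, φ₁, ψ₁, j, hφ₁, hψ₁, rfl, rfl, h1⟩ := hK.exists_extension hE hL hKL hφ hψ (hα k)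
    obtain ⟨l, ψ₂, φ₂, i, hψ₂, hφ₂, rfl, rfl, h2⟩ := hL.exists_extension hE hK hLK hψ₁ hφ₁ (hβ k)
    exact ⟨⟨l, ⟨φ₂, hφ₂⟩, ⟨ψ₂, hψ₂⟩⟩, ⟨i ∘ j, rfl, rfl⟩,
      h1.trans (Set.range_comp_subset_range _ _), h2⟩
  choose next hR hnK hnL using step
  obtain ⟨φ₀, hφ₀⟩ := hK.one_mem_embSizes hE
  obtain ⟨ψ₀, hψ₀⟩ := hL.one_mem_embSizes hE
  -- Any pair of embeddings of equal size can start the chain, and size 1 always occurs. Stage k + 1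
  -- absorbs the ranges of `α k` and `β k`.
  let p : ℕ → P := fun k => Nat.rec ⟨1, ⟨φ₀, hφ₀⟩, ⟨ψ₀, hψ₀⟩⟩ next k
  have hp : ∀ k l, k ≤ l → R (p k) (p l) := by
    intro k l hkl
    induction l, hkl using Nat.le_induction with
    | base => exact Rrefl _
    | succ l _ ih => exact Rtrans _ _ _ ih (hR l (p l))
  have coverK : ∀ x, ∃ k, x ∈ Set.range (p k).2.1.1 := fun x =>
    let ⟨k, hk⟩ := hαK x
    ⟨k + 1, hnK k (p k) hk⟩
  have coverL : ∀ y, ∃ k, y ∈ Set.range (p k).2.2.1 := fun y =>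
    let ⟨k, hk⟩ := hβL y
    ⟨k + 1, hnL k (p k) hk⟩
  -- The partial bijections are well defined and consistent: at a common later stage both embeddings
  -- are injective, so equality on either side is equality of the same two parameters.
  have key : ∀ k l z w, (p k).2.1.1 z = (p l).2.1.1 w ↔ (p k).2.2.1 z = (p l).2.2.1 w := by
    intro k l z w
    obtain ⟨i, hi1, hi2⟩ := hp k (max k l) (le_max_left _ _)
    obtain ⟨j, hj1, hj2⟩ := hp l (max k l) (le_max_right _ _)
    rw [← hi1, ← hj1, ← hi2, ← hj2]
    exact (hK.injective (p (max k l)).2.1.2).eq_iff.trans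
      (hL.injective (p (max k l)).2.2.2).eq_iff.symm
  choose kf zf hf using coverK
  choose kg zg hg using coverL
  have hfφ : ∀ k z, (p (kf ((p k).2.1.1 z))).2.2.1 (zf ((p k).2.1.1 z)) = (p k).2.2.1 z :=
    fun k z => (key _ _ _ _).1 (hf _)
  have hgψ : ∀ k z, (p (kg ((p k).2.2.1 z))).2.1.1 (zg ((p k).2.2.1 z)) = (p k).2.1.1 z :=
    fun k z => (key _ _ _ _).2 (hg _)
  let f : K ≃ L :=
    { toFun := fun x => (p (kf x)).2.2.1 (zf x)
      invFun := fun y => (p (kg y)).2.1.1 (zg y)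
      left_inv := fun x => by
        dsimp only
        rw [hgψ]; exact hf x
      right_inv := fun y => by
        dsimp only
        rw [hfφ]; exact hg y }
  refine ⟨f, fun x y => ?_⟩
  let k := max (kf x) (kf y)
  obtain ⟨i, hi, -⟩ := hp (kf x) k (le_max_left _ _)
  obtain ⟨j, hj, -⟩ := hp (kf y) k (le_max_right _ _)
  refine ⟨(p k).1, (p k).2.1.1, (p k).2.2.1, (p k).2.1.2, (p k).2.2.2,
    funext fun z => hfφ k z, ⟨i (zf x), ?_⟩, ⟨j (zf y), ?_⟩⟩
  · exact (congrFun hi _).trans (hf x)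
  · exact (congrFun hj _).trans (hf y)

end BackAndForth

/-! ### Homomorphisms of matrix algebras -/

section MatrixAlgebras

variable {F : Type*} [Field F]

/-- Ranges of equal dimension are isomorphic; `y` is `p` followed by such an isomorphism, and `x` is
`q` followed by its inverse. -/
theorem exists_mul_eq_mul_eq_of_rank_eq {k : ℕ} {p q : Matrix (Fin k) (Fin k) F}
    (hp : p * p = p) (hq : q * q = q) (h : p.rank = q.rank) :
    ∃ x y : Matrix (Fin k) (Fin k) F, x * y = p ∧ y * x = q := by
  set f := Matrix.toLin' p with hf
  set g := Matrix.toLin' q with hg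
  have hff : ∀ v, f (f v) = f v := fun v => by
    rw [hf, ← LinearMap.comp_apply, ← Matrix.toLin'_mul, hp]
  have hgg : ∀ v, g (g v) = g v := fun v => by
    rw [hg, ← LinearMap.comp_apply, ← Matrix.toLin'_mul, hq]
  have hfr : ∀ w : LinearMap.range f, f.rangeRestrict w = w := by
    rintro ⟨_, v, rfl⟩
    exact Subtype.ext (hff v)
  have hgr : ∀ w : LinearMap.range g, g.rangeRestrict w = w := by
    rintro ⟨_, v, rfl⟩
    exact Subtype.ext (hgg v)
  let θ : LinearMap.range f ≃ₗ[F] LinearMap.range g := LinearEquiv.ofFinrankEq _ _ h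
  refine ⟨LinearMap.toMatrix' ((LinearMap.range f).subtype ∘ₗ θ.symm.toLinearMap ∘ₗ
    g.rangeRestrict), LinearMap.toMatrix' ((LinearMap.range g).subtype ∘ₗ θ.toLinearMap ∘ₗ
    f.rangeRestrict), ?_, ?_⟩
  · rw [← LinearMap.toMatrix'_comp]
    apply Matrix.toLin'.injective
    rw [Matrix.toLin'_toMatrix']
    refine LinearMap.ext fun v => ?_
    simp [hgr, hf]
  · rw [← LinearMap.toMatrix'_comp]
    apply Matrix.toLin'.injective
    rw [Matrix.toLin'_toMatrix']
    refine LinearMap.ext fun v => ?_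
    simp [hfr, hg]

theorem algHom_matrix_sum_single {n : ℕ} {R : Type*} [Ring R] [Algebra F R]
    (a : Matrix (Fin n) (Fin n) F →ₐ[F] R) : ∑ i, a (Matrix.single i i 1) = 1 := by
  rw [← map_sum, ← map_one a]
  congr 1
  ext i j
  simp [Matrix.sum_apply, Matrix.single_apply, Matrix.one_apply, ite_and]

/-- Two homomorphisms between matrix algebras are conjugate. -/
theorem exists_conj_matrix_algHom {n k : ℕ} (hn : 0 < n)
    (a b : Matrix (Fin n) (Fin n) F →ₐ[F] Matrix (Fin k) (Fin k) F) :
    ∃ u v : Matrix (Fin k) (Fin k) F, u * v = 1 ∧ ∀ M, u * b M * v = a M := by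
  let o : Fin n := ⟨0, hn⟩
  have hE : ∀ i j l : Fin n, (Matrix.single i j 1 * Matrix.single j l 1 :
      Matrix (Fin n) (Fin n) F) = Matrix.single i l 1 := fun i j l => by simp
  have hE0 : ∀ i j l m : Fin n, j ≠ l → (Matrix.single i j 1 * Matrix.single l m 1 :
      Matrix (Fin n) (Fin n) F) = 0 := fun i j l m h => by simp [h]
  have hidem : ∀ c : Matrix (Fin n) (Fin n) F →ₐ[F] Matrix (Fin k) (Fin k) F,
      c (Matrix.single o o 1) * c (Matrix.single o o 1) = c (Matrix.single o o 1) := fun c => by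
    rw [← map_mul, hE]
  obtain ⟨x, y, hxy, hyx⟩ := exists_mul_eq_mul_eq_of_rank_eq (hidem a) (hidem b) (by
    have h1 := rank_algHom_matrix a (Matrix.single o o 1)
    have h2 := rank_algHom_matrix b (Matrix.single o o 1)
    exact Nat.eq_of_mul_eq_mul_left hn (h1.trans h2.symm))
  -- `x` and `y` match only the images of the corner idempotent at `o`. Matrix units carry this
  -- identification to every diagonal position, and the sum intertwines `b` and `a`.
  let u := ∑ i, a (Matrix.single i o 1) * x * b (Matrix.single o i 1)
  let v := ∑ i, b (Matrix.single i o 1) * y * a (Matrix.single o i 1)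
  have huv : u * v = 1 := by
    rw [← algHom_matrix_sum_single a, Finset.sum_mul_sum]
    refine Finset.sum_congr rfl fun i _ => ?_
    rw [Finset.sum_eq_single i]
    · calc a (Matrix.single i o 1) * x * b (Matrix.single o i 1) *
            (b (Matrix.single i o 1) * y * a (Matrix.single o i 1))
          = a (Matrix.single i o 1) * x * (b (Matrix.single o i 1) * b (Matrix.single i o 1)) *
            y * a (Matrix.single o i 1) := by simp only [mul_assoc]
        _ = a (Matrix.single i o 1) * x * (y * x) * y * a (Matrix.single o i 1) := by
            rw [← map_mul, hE, hyx]
        _ = a (Matrix.single i o 1) * (x * y) * (x * y) * a (Matrix.single o i 1) := by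
            simp only [mul_assoc]
        _ = a (Matrix.single i i 1) := by
            rw [hxy, ← map_mul, hE, ← map_mul, hE, ← map_mul, hE]
    · intro j _ hj
      calc a (Matrix.single i o 1) * x * b (Matrix.single o i 1) *
            (b (Matrix.single j o 1) * y * a (Matrix.single o j 1))
          = a (Matrix.single i o 1) * x * (b (Matrix.single o i 1) * b (Matrix.single j o 1)) *
            y * a (Matrix.single o j 1) := by simp only [mul_assoc]
        _ = 0 := by rw [← map_mul, hE0 _ _ _ _ hj.symm]; simp
    · simp
  have hcomm : ∀ M, u * b M = a M * u := by
    intro M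
    induction M using Matrix.induction_on' with
    | h_zero => simp
    | h_add p q hp hq => rw [map_add, map_add, mul_add, add_mul, hp, hq]
    | h_std_basis i j c =>
      have hc : (Matrix.single i j c : Matrix (Fin n) (Fin n) F) = c • Matrix.single i j 1 := by
        simp
      rw [hc, map_smul, map_smul, mul_smul_comm, smul_mul_assoc]
      congr 1
      rw [Finset.sum_mul, Finset.mul_sum, Finset.sum_eq_single i, Finset.sum_eq_single j]
      · rw [mul_assoc, ← map_mul, hE]
        simp only [← mul_assoc]
        rw [← map_mul, hE]
      · intro l _ hl
        rw [← mul_assoc, ← mul_assoc, ← map_mul, hE0 _ _ _ _ hl.symm]; simp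
      · simp
      · intro l _ hl
        rw [mul_assoc, ← map_mul, hE0 _ _ _ _ hl]; simp
      · simp
  exact ⟨u, v, huv, fun M => by rw [hcomm, mul_assoc, huv, mul_one]⟩

/-- Conjugation by an invertible matrix. -/
def matrixConj {k : ℕ} (u v : Matrix (Fin k) (Fin k) F) (h : u * v = 1) :
    Matrix (Fin k) (Fin k) F →ₐ[F] Matrix (Fin k) (Fin k) F :=
  AlgHom.ofLinearMap (LinearMap.mulRight F v ∘ₗ LinearMap.mulLeft F u)
    (by simp [h]) (fun x y => by
      have h' : v * u = 1 := mul_eq_one_comm.1 h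
      calc u * (x * y) * v = u * x * 1 * y * v := by simp only [mul_one, mul_assoc]
        _ = (u * x * v) * (u * y * v) := by rw [← h']; simp only [mul_assoc])

/-- Algebra homomorphisms between matrix algebras. -/
def matrixHoms (F : Type*) [Field F] (n m : ℕ) :
    Set (Matrix (Fin n) (Fin n) F → Matrix (Fin m) (Fin m) F) :=
  {f | ∃ φ : Matrix (Fin n) (Fin n) F →ₐ[F] Matrix (Fin m) (Fin m) F, ⇑φ = f}

/-- Embeddings of matrix algebras of positive size. -/
def matrixEmbs (F : Type*) [Field F] (A : Type*) [Ring A] [Algebra F A] (n : ℕ) :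
    Set (Matrix (Fin n) (Fin n) F → A) :=
  {f | 0 < n ∧ ∃ φ : Matrix (Fin n) (Fin n) F →ₐ[F] A, ⇑φ = f}

/-- For n > 0 the quotient is the rank of the image of a diagonal matrix unit; for n = 0 the source
is the zero ring, which has no unital map to a nonzero one. -/
theorem dvd_of_matrix_algHom {n m : ℕ} (hm : 0 < m)
    (φ : Matrix (Fin n) (Fin n) F →ₐ[F] Matrix (Fin m) (Fin m) F) : n ∣ m := by
  rcases Nat.eq_zero_or_pos n with rfl | hn
  · have : Nonempty (Fin m) := ⟨⟨0, hm⟩⟩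
    have h : (1 : Matrix (Fin m) (Fin m) F) = 0 := by
      rw [← map_one φ, ← map_zero φ]
      congr 1
      exact Subsingleton.elim _ _
    exact absurd h one_ne_zero
  · classical
    let o : Fin n := ⟨0, hn⟩
    have h := rank_algHom_matrix φ (Matrix.single o o 1)
    have h1 : (Matrix.single o o (1 : F)).rank = 1 := by
      have : Matrix.single o o (1 : F) = Matrix.diagonal (Pi.single o 1) := by
        rw [Matrix.diagonal_single]
      rw [this, Matrix.rank_diagonal, Fintype.card_subtype]
      rw [Finset.card_eq_one]
      refine ⟨o, ?_⟩
      ext i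
      by_cases hi : i = o <;> simp [hi, Pi.single_apply]
    rw [h1, mul_one] at h
    exact ⟨_, h.symm⟩

theorem nonempty_matrix_algHom (n d : ℕ) :
    Nonempty (Matrix (Fin n) (Fin n) F →ₐ[F] Matrix (Fin (n * d)) (Fin (n * d)) F) := by
  refine ⟨((Matrix.reindexAlgEquiv F F finProdFinEquiv).toAlgHom.comp
    (Matrix.kroneckerAlgEquiv (Fin n) (Fin d) F).toAlgHom).comp
    Algebra.TensorProduct.includeLeft⟩

theorem isStandardSystem_matrixHoms (F : Type*) [Field F] :
    IsStandardSystem (matrixHoms F) where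
  comp := by
    rintro n m k _ _ ⟨a, rfl⟩ ⟨b, rfl⟩
    exact ⟨b.comp a, rfl⟩
  dvd := by
    rintro n m _ hm ⟨a, rfl⟩
    exact dvd_of_matrix_algHom hm a
  nonempty := by
    rintro n _ hm ⟨d, rfl⟩
    obtain ⟨φ⟩ := nonempty_matrix_algHom (F := F) n d
    exact ⟨φ, φ, rfl⟩
  conj := by
    rintro n m _ _ hm ⟨a, rfl⟩ ⟨b, rfl⟩
    obtain ⟨u, v, huv, h⟩ :=
      exists_conj_matrix_algHom (Nat.pos_of_dvd_of_pos (dvd_of_matrix_algHom hm a) hm) a b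
    exact ⟨_, ⟨matrixConj u v huv, rfl⟩, funext h⟩

/-! ### Matrix subalgebras of a locally matrix algebra and Glimm's classification. -/

variable {A : Type*} [Ring A] [Algebra F A]

theorem IsLocallyMatrixAlgebra.nontrivial [IsLocallyMatrixAlgebra F A] : Nontrivial A := by
  obtain ⟨B, -, n, hn, ⟨e⟩⟩ := IsLocallyMatrixAlgebra.exists_subalgebra (F := F) (∅ : Finset A)
  have : Nonempty (Fin n) := ⟨⟨0, hn⟩⟩
  have : Nontrivial B := e.toEquiv.nontrivial
  exact Subtype.val_injective.nontrivial (α := B)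

theorem matrix_algHom_injective [Nontrivial A] {n : ℕ} (hn : 0 < n)
    (φ : Matrix (Fin n) (Fin n) F →ₐ[F] A) : Function.Injective φ := by
  have : Nonempty (Fin n) := ⟨⟨0, hn⟩⟩
  exact RingHom.injective (φ : Matrix (Fin n) (Fin n) F →+* A)

theorem exists_matrix_algHom_of_finset [IsLocallyMatrixAlgebra F A] (s : Finset A) :
    ∃ (n : ℕ) (φ : Matrix (Fin n) (Fin n) F →ₐ[F] A), 0 < n ∧ (s : Set A) ⊆ φ.range := by
  obtain ⟨B, hB, n, hn, ⟨e⟩⟩ := IsLocallyMatrixAlgebra.exists_subalgebra (F := F) s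
  refine ⟨n, B.val.comp e.symm.toAlgHom, hn, fun x hx => ⟨e ⟨x, hB hx⟩, ?_⟩⟩
  simp

theorem range_le_of_single_mem {n : ℕ} (φ : Matrix (Fin n) (Fin n) F →ₐ[F] A)
    {B : Subalgebra F A} (h : ∀ i j, φ (Matrix.single i j 1) ∈ B) : φ.range ≤ B := by
  rintro _ ⟨M, rfl⟩
  change φ M ∈ B
  induction M using Matrix.induction_on' with
  | h_zero => simp
  | h_add p q hp hq => rw [map_add]; exact B.add_mem hp hq
  | h_std_basis i j c =>
    have hc : (Matrix.single i j c : Matrix (Fin n) (Fin n) F) = c • Matrix.single i j 1 := by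
      simp
    rw [hc, map_smul]
    exact B.smul_mem (h i j) c

theorem exists_factorization_of_range_le {n k : ℕ} {φ : Matrix (Fin n) (Fin n) F →ₐ[F] A}
    {χ : Matrix (Fin k) (Fin k) F →ₐ[F] A} (hχ : Function.Injective χ)
    (h : φ.range ≤ χ.range) :
    ∃ a : Matrix (Fin n) (Fin n) F →ₐ[F] Matrix (Fin k) (Fin k) F, χ.comp a = φ := by
  refine ⟨(AlgEquiv.ofInjective χ hχ).symm.toAlgHom.comp
    (φ.codRestrict χ.range fun x => h ⟨x, rfl⟩), ?_⟩
  ext1 x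
  exact congrArg Subtype.val
    ((AlgEquiv.ofInjective χ hχ).apply_symm_apply ⟨φ x, h ⟨x, rfl⟩⟩)

/-- The images of the matrix units. -/
noncomputable def matrixUnitsImage {n : ℕ} (φ : Matrix (Fin n) (Fin n) F →ₐ[F] A) : Finset A :=
  (Set.finite_range fun ij : Fin n × Fin n => φ (Matrix.single ij.1 ij.2 1)).toFinset

theorem range_le_of_matrixUnitsImage_subset {n : ℕ} {φ : Matrix (Fin n) (Fin n) F →ₐ[F] A}
    {B : Subalgebra F A} (h : (matrixUnitsImage φ : Set A) ⊆ B) : φ.range ≤ B :=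
  range_le_of_single_mem φ fun i j => h (by simp [matrixUnitsImage])

theorem isUnionOfStandard_matrixEmbs [IsLocallyMatrixAlgebra F A]
    (hA : Module.rank F A ≤ Cardinal.aleph0) :
    IsUnionOfStandard (matrixHoms F) (matrixEmbs F A) where
  pos h := h.1
  comp := by
    rintro n m _ _ hn ⟨a, rfl⟩ ⟨-, φ, rfl⟩
    exact ⟨hn, φ.comp a, rfl⟩
  injective := by
    rintro n _ ⟨hn, φ, rfl⟩
    have := IsLocallyMatrixAlgebra.nontrivial (F := F) (A := A)
    exact matrix_algHom_injective hn φ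
  directed := by
    classical
    rintro n m _ _ ⟨hn, φ, rfl⟩ ⟨hm, ψ, rfl⟩
    have := IsLocallyMatrixAlgebra.nontrivial (F := F) (A := A)
    obtain ⟨k, χ, hk, hχ⟩ :=
      exists_matrix_algHom_of_finset (F := F) (matrixUnitsImage φ ∪ matrixUnitsImage ψ)
    rw [Finset.coe_union, Set.union_subset_iff] at hχ
    have hχi := matrix_algHom_injective hk χ
    obtain ⟨a, rfl⟩ :=
      exists_factorization_of_range_le hχi (range_le_of_matrixUnitsImage_subset hχ.1)
    obtain ⟨b, rfl⟩ :=
      exists_factorization_of_range_le hχi (range_le_of_matrixUnitsImage_subset hχ.2)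
    exact ⟨k, χ, a, b, ⟨hk, χ, rfl⟩, ⟨a, rfl⟩, ⟨b, rfl⟩, rfl, rfl⟩
  exists_seq := by
    classical
    let b := Module.Basis.ofVectorSpace F A
    have : Countable (Module.Basis.ofVectorSpaceIndex F A) := by
      rw [← Cardinal.mk_le_aleph0_iff, b.mk_eq_rank'']
      exact hA
    -- A countable basis has countably many finite subsets; each is placed in a matrix algebra, and
    -- every vector has finite support.
    obtain ⟨t, ht⟩ := exists_surjective_nat (Finset (Module.Basis.ofVectorSpaceIndex F A))
    choose N φ hN hφ using fun k => exists_matrix_algHom_of_finset (F := F) ((t k).image b)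
    refine ⟨N, fun k => φ k, fun k => ⟨hN k, φ k, rfl⟩, fun x => ?_⟩
    obtain ⟨k, hk⟩ := ht (b.repr x).support
    refine ⟨k, ?_⟩
    change x ∈ (φ k).range
    rw [← b.linearCombination_repr x, Finsupp.linearCombination_apply, Finsupp.sum]
    refine Subalgebra.sum_mem _ fun i hi => Subalgebra.smul_mem _ (hφ k ?_) _
    rw [hk]
    exact Finset.mem_coe.2 (Finset.mem_image_of_mem _ hi)

theorem algebraSt_eq [Nontrivial A] : algebraSt F A = steinitzLcm (embSizes (matrixEmbs F A)) := by
  unfold algebraSt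
  congr 1
  ext n
  constructor
  · rintro ⟨hn, B, ⟨e⟩⟩
    exact ⟨_, hn, B.val.comp e.symm.toAlgHom, rfl⟩
  · rintro ⟨_, hn, φ, -⟩
    exact ⟨hn, φ.range, ⟨(AlgEquiv.ofInjective φ (matrix_algHom_injective hn φ)).symm⟩⟩

theorem nonempty_algEquiv_of_algebraSt_eq {A₁ A₂ : Type*} [Ring A₁] [Algebra F A₁]
    [IsLocallyMatrixAlgebra F A₁] [Ring A₂] [Algebra F A₂] [IsLocallyMatrixAlgebra F A₂]
    (h₁ : Module.rank F A₁ ≤ Cardinal.aleph0) (h₂ : Module.rank F A₂ ≤ Cardinal.aleph0)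
    (h : algebraSt F A₁ = algebraSt F A₂) : Nonempty (A₁ ≃ₐ[F] A₂) := by
  have := IsLocallyMatrixAlgebra.nontrivial (F := F) (A := A₁)
  have := IsLocallyMatrixAlgebra.nontrivial (F := F) (A := A₂)
  rw [algebraSt_eq, algebraSt_eq] at h
  obtain ⟨f, hf⟩ := exists_equiv_of_steinitzLcm_eq (isStandardSystem_matrixHoms F)
    (isUnionOfStandard_matrixEmbs h₁) (isUnionOfStandard_matrixEmbs h₂) h
  refine ⟨AlgEquiv.ofLinearEquiv
    { f with
      map_add' := fun x y => ?_
      map_smul' := fun c x => ?_ } ?_ fun x y => ?_⟩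
  · obtain ⟨n, _, _, ⟨-, φ, rfl⟩, ⟨-, ψ, rfl⟩, hfφ, ⟨x, rfl⟩, ⟨y, rfl⟩⟩ := hf x y
    have hfφ' : ∀ z, f (φ z) = ψ z := congrFun hfφ
    change f (φ x + φ y) = f (φ x) + f (φ y)
    rw [← map_add, hfφ', hfφ', hfφ', map_add]
  · obtain ⟨n, _, _, ⟨-, φ, rfl⟩, ⟨-, ψ, rfl⟩, hfφ, ⟨x, rfl⟩, -⟩ := hf x x
    have hfφ' : ∀ z, f (φ z) = ψ z := congrFun hfφ
    change f (c • φ x) = c • f (φ x)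
    rw [← map_smul, hfφ', hfφ', map_smul]
  · obtain ⟨n, _, _, ⟨-, φ, rfl⟩, ⟨-, ψ, rfl⟩, hfφ, -, -⟩ := hf 1 1
    have hfφ' : ∀ z, f (φ z) = ψ z := congrFun hfφ
    change f 1 = 1
    rw [← map_one φ, hfφ', map_one]
  · obtain ⟨n, _, _, ⟨-, φ, rfl⟩, ⟨-, ψ, rfl⟩, hfφ, ⟨x, rfl⟩, ⟨y, rfl⟩⟩ := hf x y
    have hfφ' : ∀ z, f (φ z) = ψ z := congrFun hfφ
    change f (φ x * φ y) = f (φ x) * f (φ y)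
    rw [← map_mul, hfφ', hfφ', hfφ', map_mul]

theorem algebraSt_eq_of_algEquiv {A₁ A₂ : Type*} [Ring A₁] [Algebra F A₁] [Nontrivial A₁]
    [Ring A₂] [Algebra F A₂] [Nontrivial A₂] (e : A₁ ≃ₐ[F] A₂) :
    algebraSt F A₁ = algebraSt F A₂ := by
  rw [algebraSt_eq, algebraSt_eq]
  congr 1
  ext n
  constructor
  · rintro ⟨_, hn, φ, -⟩
    exact ⟨_, hn, e.toAlgHom.comp φ, rfl⟩
  · rintro ⟨_, hn, φ, -⟩
    exact ⟨_, hn, e.symm.toAlgHom.comp φ, rfl⟩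

/-- The Steinitz number of an algebra exhausted by matrix algebras of sizes `N k`. -/
theorem algebraSt_eq_of_exhaustion [Nontrivial A] {N : ℕ → ℕ} (hN : ∀ k, 0 < N k)
    (φ : ∀ k, Matrix (Fin (N k)) (Fin (N k)) F →ₐ[F] A)
    (hφ : ∀ s : Finset A, ∃ k, (s : Set A) ⊆ (φ k).range) :
    algebraSt F A = steinitzLcm (Set.range N) := by
  rw [algebraSt_eq]
  refine steinitzLcm_eq_of_dvd ?_ ?_
  · rintro n ⟨_, hn, ψ, -⟩
    obtain ⟨k, hk⟩ := hφ (matrixUnitsImage ψ)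
    obtain ⟨a, -⟩ := exists_factorization_of_range_le (matrix_algHom_injective (hN k) (φ k))
      (range_le_of_matrixUnitsImage_subset hk)
    exact ⟨N k, ⟨k, rfl⟩, (hN k).ne', dvd_of_matrix_algHom (hN k) a⟩
  · rintro _ ⟨k, rfl⟩
    exact ⟨N k, ⟨_, hN k, φ k, rfl⟩, (hN k).ne', dvd_rfl⟩

end MatrixAlgebras

/-! ### Homomorphisms of standard Hamming spaces -/

section HammingSpaces

theorem rank_std {n : ℕ} [NeZero n] (x : Fin n → ZMod 2) :
    HammingSpace.rank x = (∑ i, ((x i).val : ℝ)) / n := rfl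

theorem HammingSpace.rank_zero {S : Type*} [BooleanRing S] [HammingSpace S] :
    HammingSpace.rank (0 : S) = 0 := (HammingSpace.rank_eq_zero_iff _).2 rfl

theorem HammingSpace.rank_one {S : Type*} [BooleanRing S] [HammingSpace S] :
    HammingSpace.rank (1 : S) = 1 := (HammingSpace.rank_eq_one_iff _).2 rfl

theorem HammingSpace.rank_sum {S : Type*} [BooleanRing S] [HammingSpace S] {ι : Type*}
    (e : ι → S) (he : ∀ i j, i ≠ j → e i * e j = 0) (s : Finset ι) :
    HammingSpace.rank (∑ i ∈ s, e i) = ∑ i ∈ s, HammingSpace.rank (e i) := by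
  classical
  induction s using Finset.induction_on with
  | empty => simp [HammingSpace.rank_zero]
  | insert a s ha ih =>
    rw [Finset.sum_insert ha, Finset.sum_insert ha, HammingSpace.rank_add, ih]
    rw [Finset.mul_sum]
    exact Finset.sum_eq_zero fun i hi => he _ _ fun h => ha (h ▸ hi)

theorem zmod_two_eq_zero_or_one : ∀ x : ZMod 2, x = 0 ∨ x = 1 := by decide

theorem std_eq_sum_single {n : ℕ} (x : Fin n → ZMod 2) :
    x = ∑ i with x i = 1, (Pi.single i 1 : Fin n → ZMod 2) := by
  funext l
  rw [Finset.sum_apply, Finset.sum_filter]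
  rcases zmod_two_eq_zero_or_one (x l) with h | h
  · rw [h]
    symm
    refine Finset.sum_eq_zero fun i _ => ?_
    split_ifs with hi
    · rw [Pi.single_eq_of_ne]
      rintro rfl
      rw [h] at hi
      exact zero_ne_one hi
    · rfl
  · rw [h, Finset.sum_eq_single l]
    · simp [h]
    · intro i _ hi
      simp [Pi.single_eq_of_ne hi.symm]
    · simp

theorem rank_std_single {n : ℕ} [NeZero n] (i : Fin n) :
    HammingSpace.rank (Pi.single i 1 : Fin n → ZMod 2) = 1 / n := by
  rw [rank_std, Finset.sum_eq_single i]
  · simp [ZMod.val_one, -ZMod.natCast_val]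
  · intro j _ hj
    simp [Pi.single_eq_of_ne hj]
  · simp [ZMod.val_one, -ZMod.natCast_val]

theorem single_mul_single_of_ne {n : ℕ} {i j : Fin n} (h : i ≠ j) :
    (Pi.single i 1 * Pi.single j 1 : Fin n → ZMod 2) = 0 := by
  funext l
  by_cases hl : l = i
  · subst hl; simp [Pi.single_eq_of_ne h]
  · simp [Pi.single_eq_of_ne hl]

/-- A homomorphism from a standard space preserves ranks as soon as it does not decrease those of
the atoms. -/
theorem rank_map_of_le {S : Type*} [BooleanRing S] [HammingSpace S] {n : ℕ} [NeZero n]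
    (φ : (Fin n → ZMod 2) →+* S)
    (h : ∀ i, 1 / (n : ℝ) ≤ HammingSpace.rank (φ (Pi.single i 1))) (x : Fin n → ZMod 2) :
    HammingSpace.rank (φ x) = HammingSpace.rank x := by
  have hn : (n : ℝ) ≠ 0 := by exact_mod_cast NeZero.ne n
  have horth : ∀ i j : Fin n, i ≠ j → φ (Pi.single i 1) * φ (Pi.single j 1) = 0 := fun i j hij => by
    rw [← map_mul, single_mul_single_of_ne hij, map_zero]
  -- The images of the atoms are orthogonal with sum 1, so their ranks add up to n · (1/n); termwise
  -- inequalities with equal sums are equalities.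
  have hsum : ∑ i, HammingSpace.rank (φ (Pi.single i 1)) = ∑ _i : Fin n, 1 / (n : ℝ) := by
    rw [← HammingSpace.rank_sum _ horth, ← map_sum]
    have : ∑ i, (Pi.single i 1 : Fin n → ZMod 2) = 1 := by
      conv_rhs => rw [std_eq_sum_single (1 : Fin n → ZMod 2)]
      simp
    rw [this, map_one, HammingSpace.rank_one]
    simp [hn]
  have heq : ∀ i, HammingSpace.rank (φ (Pi.single i 1)) = 1 / (n : ℝ) := fun i =>
    ((Finset.sum_eq_sum_iff_of_le fun i _ => h i).1 hsum.symm i (Finset.mem_univ i)).symm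
  rw [std_eq_sum_single x, map_sum, HammingSpace.rank_sum _ horth, HammingSpace.rank_sum]
  · exact Finset.sum_congr rfl fun i _ => by rw [heq, rank_std_single]
  · exact fun i j hij => single_mul_single_of_ne hij

/-- Rank-preserving homomorphisms from standard Hamming spaces. -/
def hammingEmbs (S : Type*) [BooleanRing S] [HammingSpace S] (n : ℕ) :
    Set ((Fin n → ZMod 2) → S) :=
  {f | ∃ (_ : NeZero n) (φ : (Fin n → ZMod 2) →+* S),
    (∀ x, HammingSpace.rank (φ x) = HammingSpace.rank x) ∧ ⇑φ = f}

/-- Rank-preserving homomorphisms between standard Hamming spaces. -/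
def hammingHoms (n m : ℕ) : Set ((Fin n → ZMod 2) → (Fin m → ZMod 2)) :=
  {f | ∃ _ : NeZero m, f ∈ hammingEmbs (Fin m → ZMod 2) n}

theorem hammingEmbs_comp {S : Type*} [BooleanRing S] [HammingSpace S] {n m : ℕ}
    {a : (Fin n → ZMod 2) → (Fin m → ZMod 2)} {φ : (Fin m → ZMod 2) → S}
    (ha : a ∈ hammingHoms n m) (hφ : φ ∈ hammingEmbs S m) : φ ∘ a ∈ hammingEmbs S n := by
  obtain ⟨_, hn, a, ha, rfl⟩ := ha
  obtain ⟨hm, φ, hφ, rfl⟩ := hφ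
  exact ⟨hn, φ.comp a, fun x => (hφ _).trans (ha x), rfl⟩

theorem injective_of_rank_map {S T : Type*} [BooleanRing S] [HammingSpace S] [BooleanRing T]
    [HammingSpace T] (φ : T →+* S)
    (hφ : ∀ x, HammingSpace.rank (φ x) = HammingSpace.rank x) : Function.Injective φ := by
  rw [injective_iff_map_eq_zero]
  intro x hx
  rw [← HammingSpace.rank_eq_zero_iff, ← hφ, hx, HammingSpace.rank_zero]

/-- Duality between finite Boolean algebras and finite sets: at each target coordinate the images of
the atoms sum to 1, so some atom is sent to 1 there, and its index is the point. -/
theorem exists_index_map {n m : ℕ} (φ : (Fin n → ZMod 2) →+* (Fin m → ZMod 2)) :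
    ∃ α : Fin m → Fin n, ∀ x l, φ x l = x (α l) := by
  have : ∀ l, ∃ i, φ (Pi.single i 1) l = 1 := by
    intro l
    by_contra! h
    have h0 : ∀ i, φ (Pi.single i 1) l = 0 := fun i =>
      (zmod_two_eq_zero_or_one _).resolve_right (h i)
    have h1 : φ 1 l = 0 := by
      rw [std_eq_sum_single (1 : Fin n → ZMod 2), map_sum, Finset.sum_apply]
      exact Finset.sum_eq_zero fun i _ => h0 i
    rw [map_one] at h1
    exact one_ne_zero h1
  choose α hα using this
  refine ⟨α, fun x l => ?_⟩
  have h : φ x l = φ (x * Pi.single (α l) 1) l := by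
    rw [map_mul, Pi.mul_apply, hα, mul_one]
  rw [h]
  rcases zmod_two_eq_zero_or_one (x (α l)) with h0 | h1
  · have : x * Pi.single (α l) 1 = 0 := by
      funext i
      by_cases hi : i = α l
      · subst hi; simp [h0]
      · simp [Pi.single_eq_of_ne hi]
    rw [this, map_zero, h0, Pi.zero_apply]
  · have : x * Pi.single (α l) 1 = Pi.single (α l) 1 := by
      funext i
      by_cases hi : i = α l
      · subst hi; simp [h1]
      · simp [Pi.single_eq_of_ne hi]
    rw [this, hα, h1]

/-- The atom at i has rank 1/n, while its image is the indicator of the fibre over i, of rank (fibre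
size)/m. -/
theorem card_fiber_mul {n m : ℕ} [NeZero n] [NeZero m]
    {φ : (Fin n → ZMod 2) →+* (Fin m → ZMod 2)}
    (hφ : ∀ x, HammingSpace.rank (φ x) = HammingSpace.rank x) {α : Fin m → Fin n}
    (hα : ∀ x l, φ x l = x (α l)) (i : Fin n) : Fintype.card {l // α l = i} * n = m := by
  have hn : (n : ℝ) ≠ 0 := by exact_mod_cast NeZero.ne n
  have hm : (m : ℝ) ≠ 0 := by exact_mod_cast NeZero.ne m
  have h := hφ (Pi.single i 1)
  rw [rank_std_single, rank_std] at h
  have hs : ∑ l, ((φ (Pi.single i 1) l).val : ℝ) = (Fintype.card {l // α l = i} : ℝ) := by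
    rw [Fintype.card_subtype, Finset.card_filter, Nat.cast_sum]
    refine Finset.sum_congr rfl fun l _ => ?_
    rw [hα]
    by_cases hl : α l = i
    · simp [hl, ZMod.val_one, -ZMod.natCast_val]
    · simp [hl]
  rw [hs, div_eq_div_iff hm hn, one_mul] at h
  exact_mod_cast h

/-- The homomorphism of standard spaces given by a map of coordinates. -/
def stdComap {n m : ℕ} (α : Fin m → Fin n) : (Fin n → ZMod 2) →+* (Fin m → ZMod 2) where
  toFun x := x ∘ α
  map_one' := rfl
  map_mul' _ _ := rfl
  map_zero' := rfl
  map_add' _ _ := rfl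

theorem exists_perm_of_card_fiber_eq {n m : ℕ} {α β : Fin m → Fin n}
    (h : ∀ i, Fintype.card {l // α l = i} = Fintype.card {l // β l = i}) :
    ∃ σ : Fin m ≃ Fin m, ∀ l, β (σ l) = α l := by
  refine ⟨(Equiv.sigmaFiberEquiv α).symm.trans ((Equiv.sigmaCongrRight fun i =>
    Fintype.equivOfCardEq (h i)).trans (Equiv.sigmaFiberEquiv β)), fun l => ?_⟩
  exact (Fintype.equivOfCardEq (h (α l)) ⟨l, rfl⟩).2

/-- Rank-preserving maps correspond to maps of coordinates with all fibres of size m/n. Such a map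
is a product projection up to a permutation of the source, which gives both existence and conjugacy.
-/
theorem isStandardSystem_hammingHoms : IsStandardSystem hammingHoms where
  comp := by
    rintro n m k a b ha ⟨hk, hb⟩
    exact ⟨hk, hammingEmbs_comp ha hb⟩
  dvd := by
    rintro n m _ - ⟨hm, hn, φ, hφ, rfl⟩
    obtain ⟨α, hα⟩ := exists_index_map φ
    exact ⟨_, (mul_comm _ _).trans (card_fiber_mul hφ hα 0) |>.symm⟩
  nonempty := by
    rintro n _ hm ⟨d, rfl⟩
    have hn : NeZero n := ⟨fun h => by simp [h] at hm⟩
    have hd : NeZero d := ⟨fun h => by simp [h] at hm⟩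
    have hn' : (n : ℝ) ≠ 0 := by exact_mod_cast NeZero.ne n
    have hd' : (d : ℝ) ≠ 0 := by exact_mod_cast NeZero.ne d
    refine ⟨_, ⟨hm.ne'⟩, hn, stdComap fun l => (finProdFinEquiv.symm l).1, fun x => ?_, rfl⟩
    have hm' : NeZero (n * d) := ⟨hm.ne'⟩
    rw [rank_std, rank_std]
    change (∑ l : Fin (n * d), ((x (finProdFinEquiv.symm l).1).val : ℝ)) / _ = _
    rw [Equiv.sum_comp finProdFinEquiv.symm (fun p : Fin n × Fin d => ((x p.1).val : ℝ)),
      Fintype.sum_prod_type]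
    simp only [Finset.sum_const, Finset.card_univ, Fintype.card_fin, nsmul_eq_mul]
    rw [← Finset.mul_sum, Nat.cast_mul, mul_comm (n : ℝ), mul_div_mul_left _ _ hd']
  conj := by
    rintro n m _ _ - ⟨hm, hn, φ, hφ, rfl⟩ ⟨_, _, ψ, hψ, rfl⟩
    obtain ⟨α, hα⟩ := exists_index_map φ
    obtain ⟨β, hβ⟩ := exists_index_map ψ
    obtain ⟨σ, hσ⟩ := exists_perm_of_card_fiber_eq (α := α) (β := β) fun i =>
      Nat.eq_of_mul_eq_mul_right (Nat.pos_of_ne_zero (NeZero.ne n))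
        ((card_fiber_mul hφ hα i).trans (card_fiber_mul hψ hβ i).symm)
    refine ⟨_, ⟨hm, hm, stdComap σ, fun x => ?_, rfl⟩, ?_⟩
    · rw [rank_std, rank_std]
      congr 1
      exact Equiv.sum_comp σ fun l => ((x l).val : ℝ)
    · funext x l
      change ψ x (σ l) = φ x l
      rw [hα, hβ, hσ]

/-! ### Standard subspaces of a Hamming space and the classification of countable locally standard
spaces. -/

variable {S : Type*} [BooleanRing S] [HammingSpace S]

theorem exists_factorization_of_subset_range {n k : ℕ} [NeZero n] [NeZero k]
    {φ : (Fin n → ZMod 2) →+* S} (hφ : ∀ x, HammingSpace.rank (φ x) = HammingSpace.rank x)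
    {χ : (Fin k → ZMod 2) →+* S} (hχ : ∀ x, HammingSpace.rank (χ x) = HammingSpace.rank x)
    (h : Set.range φ ⊆ Set.range χ) : ∃ a ∈ hammingHoms n k, χ ∘ a = φ := by
  let e := RingEquiv.ofBijective χ.rangeRestrict
    ⟨fun x y hxy => injective_of_rank_map χ hχ (congrArg Subtype.val hxy),
      χ.rangeRestrict_surjective⟩
  have he : ∀ y, χ (e.symm y) = y := fun y => congrArg Subtype.val (e.apply_symm_apply y)
  refine ⟨_, ⟨inferInstance, inferInstance, (e.symm : χ.range →+* _).comp
    (φ.codRestrict χ.range fun x => h ⟨x, rfl⟩), fun x => ?_, rfl⟩, ?_⟩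
  · rw [← hχ, ← hφ x]
    congr 1
    exact he _
  · funext x
    exact he _

theorem exists_hammingEmb_of_finset (hS : IsLocallyStandard S) (s : Finset S) :
    ∃ (n : ℕ) (_ : NeZero n) (φ : (Fin n → ZMod 2) →+* S),
      (∀ x, HammingSpace.rank (φ x) = HammingSpace.rank x) ∧ (s : Set S) ⊆ Set.range φ := by
  obtain ⟨T, hT, n, hn, ⟨e⟩⟩ := hS s
  refine ⟨n, hn, T.subtype.comp (e.toRingEquiv.symm : _ →+* T), fun x => ?_, fun x hx =>
    ⟨e.toRingEquiv ⟨x, hT hx⟩, ?_⟩⟩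
  · have h := e.rank_map (e.toRingEquiv.symm x)
    have h' : e.toFun (e.toRingEquiv.symm x) = x := e.toRingEquiv.apply_symm_apply x
    rw [h'] at h
    exact h.symm
  · exact congrArg Subtype.val (e.toRingEquiv.symm_apply_apply ⟨x, hT hx⟩)

theorem isUnionOfStandard_hammingEmbs [Countable S] (hS : IsLocallyStandard S) :
    IsUnionOfStandard hammingHoms (hammingEmbs S) where
  pos := by
    rintro n _ ⟨hn, -⟩
    exact Nat.pos_of_ne_zero (NeZero.ne n)
  comp _ ha hφ := hammingEmbs_comp ha hφ
  injective := by
    rintro n _ ⟨hn, φ, hφ, rfl⟩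
    exact injective_of_rank_map φ hφ
  directed := by
    classical
    rintro n m _ _ ⟨hn, φ, hφ, rfl⟩ ⟨hm, ψ, hψ, rfl⟩
    obtain ⟨k, hk, χ, hχ, h⟩ := exists_hammingEmb_of_finset hS
      (Finset.univ.image φ ∪ Finset.univ.image ψ)
    rw [Finset.coe_union, Set.union_subset_iff] at h
    obtain ⟨a, ha, hχa⟩ := exists_factorization_of_subset_range hφ hχ (by simpa using h.1)
    obtain ⟨b, hb, hχb⟩ := exists_factorization_of_subset_range hψ hχ (by simpa using h.2)
    exact ⟨k, χ, a, b, ⟨hk, χ, hχ, rfl⟩, ha, hb, hχa, hχb⟩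
  exists_seq := by
    have : Nonempty S := ⟨0⟩
    obtain ⟨t, ht⟩ := exists_surjective_nat S
    choose N hN φ hφ hφt using fun k => exists_hammingEmb_of_finset hS {t k}
    refine ⟨N, fun k => φ k, fun k => ⟨hN k, φ k, hφ k, rfl⟩, fun x => ?_⟩
    obtain ⟨k, rfl⟩ := ht x
    exact ⟨k, hφt k (by simp)⟩

theorem exists_hammingIso_of_emb {n : ℕ} [NeZero n] (φ : (Fin n → ZMod 2) →+* S)
    (hφ : ∀ x, HammingSpace.rank (φ x) = HammingSpace.rank x) :
    Nonempty (HammingIso φ.range (Fin n → ZMod 2)) := by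
  let e := RingEquiv.ofBijective φ.rangeRestrict
    ⟨fun x y hxy => injective_of_rank_map φ hφ (congrArg Subtype.val hxy),
      φ.rangeRestrict_surjective⟩
  have he : ∀ y, φ (e.symm y) = y := fun y => congrArg Subtype.val (e.apply_symm_apply y)
  refine ⟨{ e.symm with rank_map := fun y => ?_ }⟩
  change HammingSpace.rank (e.symm y) = HammingSpace.rank (y : S)
  rw [← hφ, he]

theorem hammingSt_eq : hammingSt S = steinitzLcm (embSizes (hammingEmbs S)) := by
  unfold hammingSt
  congr 1
  ext n
  constructor
  · rintro ⟨hn, T, ⟨e⟩⟩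
    refine ⟨_, hn, T.subtype.comp (e.toRingEquiv.symm : _ →+* T), fun x => ?_, rfl⟩
    have h := e.rank_map (e.toRingEquiv.symm x)
    have h' : e.toFun (e.toRingEquiv.symm x) = x := e.toRingEquiv.apply_symm_apply x
    rw [h'] at h
    exact h.symm
  · rintro ⟨_, hn, φ, hφ, -⟩
    exact ⟨hn, φ.range, exists_hammingIso_of_emb φ hφ⟩

theorem nonempty_hammingIso_of_hammingSt_eq {S₁ S₂ : Type*} [BooleanRing S₁] [HammingSpace S₁]
    [BooleanRing S₂] [HammingSpace S₂] [Countable S₁] [Countable S₂]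
    (h₁ : IsLocallyStandard S₁) (h₂ : IsLocallyStandard S₂) (h : hammingSt S₁ = hammingSt S₂) :
    Nonempty (HammingIso S₁ S₂) := by
  rw [hammingSt_eq, hammingSt_eq] at h
  obtain ⟨f, hf⟩ := exists_equiv_of_steinitzLcm_eq isStandardSystem_hammingHoms
    (isUnionOfStandard_hammingEmbs h₁) (isUnionOfStandard_hammingEmbs h₂) h
  refine ⟨{ f with
    map_mul' := fun x y => ?_
    map_add' := fun x y => ?_
    rank_map := fun x => ?_ }⟩
  · obtain ⟨n, _, _, ⟨hn, φ, hφ, rfl⟩, ⟨_, ψ, hψ, rfl⟩, hfφ, ⟨x, rfl⟩, ⟨y, rfl⟩⟩ := hf x y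
    have hfφ' : ∀ z, f (φ z) = ψ z := congrFun hfφ
    change f (φ x * φ y) = f (φ x) * f (φ y)
    rw [← map_mul, hfφ', hfφ', hfφ', map_mul]
  · obtain ⟨n, _, _, ⟨hn, φ, hφ, rfl⟩, ⟨_, ψ, hψ, rfl⟩, hfφ, ⟨x, rfl⟩, ⟨y, rfl⟩⟩ := hf x y
    have hfφ' : ∀ z, f (φ z) = ψ z := congrFun hfφ
    change f (φ x + φ y) = f (φ x) + f (φ y)
    rw [← map_add, hfφ', hfφ', hfφ', map_add]
  · obtain ⟨n, _, _, ⟨hn, φ, hφ, rfl⟩, ⟨_, ψ, hψ, rfl⟩, hfφ, ⟨x, rfl⟩, -⟩ := hf x x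
    have hfφ' : ∀ z, f (φ z) = ψ z := congrFun hfφ
    change HammingSpace.rank (f (φ x)) = _
    rw [hfφ', hφ, hψ]

theorem hammingSt_eq_of_hammingIso {S₁ S₂ : Type*} [BooleanRing S₁] [HammingSpace S₁]
    [BooleanRing S₂] [HammingSpace S₂] (e : HammingIso S₁ S₂) :
    hammingSt S₁ = hammingSt S₂ := by
  rw [hammingSt_eq, hammingSt_eq]
  congr 1
  ext n
  constructor
  · rintro ⟨_, hn, φ, hφ, -⟩
    exact ⟨_, hn, (e.toRingEquiv : S₁ →+* S₂).comp φ,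
      fun x => (e.rank_map (φ x)).trans (hφ x), rfl⟩
  · rintro ⟨_, hn, φ, hφ, -⟩
    refine ⟨_, hn, (e.toRingEquiv.symm : S₂ →+* S₁).comp φ, fun x => ?_, rfl⟩
    rw [← hφ x, RingHom.comp_apply]
    refine (e.rank_map _).symm.trans (congrArg HammingSpace.rank ?_)
    exact e.toRingEquiv.apply_symm_apply (φ x)

/-- The Steinitz number of a Hamming space exhausted by standard spaces of sizes `N k`. -/
theorem hammingSt_eq_of_exhaustion {N : ℕ → ℕ} [∀ k, NeZero (N k)]
    (φ : ∀ k, (Fin (N k) → ZMod 2) →+* S)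
    (hφ : ∀ k x, HammingSpace.rank (φ k x) = HammingSpace.rank x)
    (hs : ∀ s : Finset S, ∃ k, (s : Set S) ⊆ Set.range (φ k)) :
    hammingSt S = steinitzLcm (Set.range N) := by
  classical
  rw [hammingSt_eq]
  refine steinitzLcm_eq_of_dvd ?_ ?_
  · rintro n ⟨_, hn, ψ, hψ, -⟩
    obtain ⟨k, hk⟩ := hs (Finset.univ.image ψ)
    obtain ⟨a, ha, -⟩ := exists_factorization_of_subset_range hψ (hφ k) (by simpa using hk)
    exact ⟨N k, ⟨k, rfl⟩, NeZero.ne _,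
      isStandardSystem_hammingHoms.dvd (Nat.pos_of_ne_zero (NeZero.ne _)) ha⟩
  · rintro _ ⟨k, rfl⟩
    exact ⟨N k, ⟨_, inferInstance, φ k, hφ k, rfl⟩, NeZero.ne _, dvd_rfl⟩

theorem isLocallyStandard_of_exhaustion {N : ℕ → ℕ} [∀ k, NeZero (N k)]
    (φ : ∀ k, (Fin (N k) → ZMod 2) →+* S)
    (hφ : ∀ k x, HammingSpace.rank (φ k x) = HammingSpace.rank x)
    (hs : ∀ s : Finset S, ∃ k, (s : Set S) ⊆ Set.range (φ k)) : IsLocallyStandard S := fun s =>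
  let ⟨k, hk⟩ := hs s
  ⟨(φ k).range, hk, N k, inferInstance, exists_hammingIso_of_emb (φ k) (hφ k)⟩

theorem countable_of_exhaustion {T : Type*} {N : ℕ → ℕ} (φ : ∀ k, (Fin (N k) → ZMod 2) → T)
    (hs : ∀ s : Finset T, ∃ k, (s : Set T) ⊆ Set.range (φ k)) : Countable T := by
  rw [← Set.countable_univ_iff]
  refine (Set.countable_iUnion fun k => (Set.finite_range (φ k)).countable).mono fun x _ => ?_
  obtain ⟨k, hk⟩ := hs {x}
  exact Set.mem_iUnion.2 ⟨k, hk (by simp)⟩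

end HammingSpaces

/-! ### Matrix subalgebras split by a family of idempotents -/

section SplitPairs

open scoped TensorProduct

variable {F : Type*} [Field F] {A : Type*} [Ring A] [Algebra F A]

theorem range_comp_algEquiv {R S : Type*} [Ring R] [Algebra F R] [Ring S] [Algebra F S]
    (f : S →ₐ[F] A) (e : R ≃ₐ[F] S) : (f.comp e.toAlgHom).range = f.range :=
  SetLike.coe_injective (e.surjective.range_comp f)

theorem tensorProduct_lift_range {R S : Type*} [Ring R] [Algebra F R] [Ring S] [Algebra F S]
    (f : R →ₐ[F] A) (g : S →ₐ[F] A) (h : ∀ x y, Commute (f x) (g y)) :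
    (Algebra.TensorProduct.lift f g h).range = f.range ⊔ g.range := by
  refine le_antisymm ?_ (sup_le ?_ ?_)
  · rintro _ ⟨t, rfl⟩
    change Algebra.TensorProduct.lift f g h t ∈ _
    induction t using TensorProduct.induction_on with
    | zero => rw [map_zero]; exact Subalgebra.zero_mem _
    | tmul x y =>
      rw [Algebra.TensorProduct.lift_tmul]
      exact Subalgebra.mul_mem _ ((le_sup_left : f.range ≤ _) ⟨x, rfl⟩)
        ((le_sup_right : g.range ≤ _) ⟨y, rfl⟩)
    | add s t hs ht => rw [map_add]; exact Subalgebra.add_mem _ hs ht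
  · rintro _ ⟨x, rfl⟩
    exact ⟨x ⊗ₜ 1, by simp⟩
  · rintro _ ⟨x, rfl⟩
    exact ⟨1 ⊗ₜ x, by simp⟩

/-- Commuting subalgebras make multiplication a homomorphism from their tensor product, whose range
is therefore already the generated subalgebra. -/
theorem sup_toSubmodule_of_commute (G₁ G₂ : Subalgebra F A)
    (h : ∀ x ∈ G₁, ∀ y ∈ G₂, x * y = y * x) :
    Subalgebra.toSubmodule (G₁ ⊔ G₂) =
      Subalgebra.toSubmodule G₁ * Subalgebra.toSubmodule G₂ := by
  refine le_antisymm ?_ (Subalgebra.mul_toSubmodule_le _ _)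
  have hc : ∀ (x : G₁) (y : G₂), Commute (G₁.val x) (G₂.val y) := fun x y => h x x.2 y y.2
  have hr := tensorProduct_lift_range G₁.val G₂.val hc
  rw [Subalgebra.range_val, Subalgebra.range_val] at hr
  rw [← hr]
  rintro _ ⟨t, rfl⟩
  change Algebra.TensorProduct.lift G₁.val G₂.val hc t ∈ _
  induction t using TensorProduct.induction_on with
  | zero => rw [map_zero]; exact Submodule.zero_mem _
  | tmul x y =>
    rw [Algebra.TensorProduct.lift_tmul]
    exact Submodule.mul_mem_mul x.2 y.2
  | add s t hs ht => rw [map_add]; exact Submodule.add_mem _ hs ht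

/-- `D` is the image of the algebra of `N × N` matrices, and `G` is spanned by the images of a
complete family of `N` nonzero orthogonal idempotents. -/
def IsSplitPair (D G : Subalgebra F A) (N : ℕ) : Prop :=
  ∃ (φ : Matrix (Fin N) (Fin N) F →ₐ[F] A) (a : Fin N → Matrix (Fin N) (Fin N) F),
    φ.range = D ∧ CompleteOrthogonalIdempotents a ∧ (∀ i, a i ≠ 0) ∧
    Submodule.span F (Set.range fun i => φ (a i)) = Subalgebra.toSubmodule G

theorem isSplitPair_bot : IsSplitPair (⊥ : Subalgebra F A) ⊥ 1 := by
  let e : Matrix (Fin 1) (Fin 1) F ≃ₐ[F] F :=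
    (AlgEquiv.ofBijective (Algebra.ofId F (Matrix (Fin 1) (Fin 1) F))
      ⟨FaithfulSMul.algebraMap_injective _ _, fun M => ⟨M 0 0, by
        ext i j
        fin_cases i
        fin_cases j
        simp [Algebra.ofId_apply, Matrix.algebraMap_matrix_apply]⟩⟩).symm
  refine ⟨(Algebra.ofId F A).comp e.toAlgHom, fun _ => 1, ?_, ?_, fun _ => one_ne_zero, ?_⟩
  · rw [range_comp_algEquiv]
    exact Algebra.range_ofId
  · rw [CompleteOrthogonalIdempotents.unique_iff]
  · simp [Algebra.toSubmodule_bot, Submodule.one_eq_span]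

/-- The idempotents are the standard basis of F^N, carried to `G` by `g` and read as matrices
through `e`. No conjugation to diagonal form is needed. -/
theorem isSplitPair_of_algEquiv {D G : Subalgebra F A} {N : ℕ} (hGD : G ≤ D)
    (e : D ≃ₐ[F] Matrix (Fin N) (Fin N) F) (g : G ≃ₐ[F] (Fin N → F)) : IsSplitPair D G N := by
  let f : (Fin N → F) →ₐ[F] Matrix (Fin N) (Fin N) F :=
    e.toAlgHom.comp ((Subalgebra.inclusion hGD).comp g.symm.toAlgHom)
  have hf : Function.Injective f := e.injective.comp
    ((Subalgebra.inclusion_injective hGD).comp g.symm.injective)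
  refine ⟨D.val.comp e.symm.toAlgHom, fun i => f (Pi.single i 1), ?_,
    CompleteOrthogonalIdempotents.map f.toRingHom (.single fun _ : Fin N => F),
    fun i h => ?_, ?_⟩
  · rw [range_comp_algEquiv, Subalgebra.range_val]
  · rw [map_eq_zero_iff f hf] at h
    simpa using congrFun h i
  · have h : ∀ x, (D.val.comp e.symm.toAlgHom) (f x) = (g.symm x : A) := fun x => by
      simp [f]
    simp only [h]
    have hr : (Set.range fun i => ((g.symm (Pi.single i 1) : G) : A)) =
        (G.val.comp g.symm.toAlgHom).toLinearMap '' Set.range (Pi.basisFun F (Fin N)) := by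
      rw [← Set.range_comp]
      congr 1
      funext i
      simp
    rw [hr, ← Submodule.map_span, Module.Basis.span_eq, Submodule.map_top]
    ext x
    constructor
    · rintro ⟨y, rfl⟩
      exact (g.symm y).2
    · intro hx
      exact ⟨g ⟨x, hx⟩, by simp⟩

/-- Kronecker product identifies the tensor product of the two matrix algebras with matrices of size
N₁N₂, and the products a_i ⊗ b_j form the new family. -/
theorem IsSplitPair.sup {D₁ G₁ D₂ G₂ : Subalgebra F A} {N₁ N₂ : ℕ} (h₁ : IsSplitPair D₁ G₁ N₁)
    (h₂ : IsSplitPair D₂ G₂ N₂) (hG₁ : G₁ ≤ D₁) (hG₂ : G₂ ≤ D₂)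
    (hcomm : ∀ x ∈ D₁, ∀ y ∈ D₂, x * y = y * x) :
    IsSplitPair (D₁ ⊔ D₂) (G₁ ⊔ G₂) (N₁ * N₂) := by
  obtain ⟨φ, a, rfl, ha, ha0, hφ⟩ := h₁
  obtain ⟨ψ, b, rfl, hb, hb0, hψ⟩ := h₂
  have hc : ∀ x y, Commute (φ x) (ψ y) := fun x y => hcomm _ ⟨x, rfl⟩ _ ⟨y, rfl⟩
  let ρ : Matrix (Fin N₁) (Fin N₁) F ⊗[F] Matrix (Fin N₂) (Fin N₂) F ≃ₐ[F]
      Matrix (Fin (N₁ * N₂)) (Fin (N₁ * N₂)) F :=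
    (Matrix.kroneckerAlgEquiv (Fin N₁) (Fin N₂) F).trans
      (Matrix.reindexAlgEquiv F F finProdFinEquiv)
  let t : Fin N₁ × Fin N₂ → Matrix (Fin N₁) (Fin N₁) F ⊗[F] Matrix (Fin N₂) (Fin N₂) F :=
    fun p => a p.1 ⊗ₜ b p.2
  have ht : CompleteOrthogonalIdempotents t := by
    rw [CompleteOrthogonalIdempotents.iff_ortho_complete]
    constructor
    · rintro ⟨i, j⟩ ⟨i', j'⟩ hij
      change a i ⊗ₜ[F] b j * a i' ⊗ₜ[F] b j' = 0
      rw [Algebra.TensorProduct.tmul_mul_tmul, ha.mul_eq, hb.mul_eq]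
      by_cases h : i = i'
      · have : j ≠ j' := fun h' => hij (by rw [h, h'])
        rw [if_neg this, TensorProduct.tmul_zero]
      · rw [if_neg h, TensorProduct.zero_tmul]
    · simp only [t]
      rw [Fintype.sum_prod_type]
      simp only [← TensorProduct.tmul_sum, ← TensorProduct.sum_tmul]
      rw [ha.complete, hb.complete]
      rfl
  have ht0 : ∀ p, t p ≠ 0 := by
    rintro ⟨i, j⟩ h
    have h' : kroneckerLinearEquiv _ _ _ _ F (a i ⊗ₜ[F] b j) = 0 := by
      rw [show a i ⊗ₜ[F] b j = 0 from h, map_zero]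
    rw [kroneckerLinearEquiv_tmul] at h'
    obtain ⟨r, s, hrs⟩ : ∃ r s, a i r s ≠ 0 := by
      by_contra! h0
      exact ha0 i (Matrix.ext h0)
    obtain ⟨r', s', hrs'⟩ : ∃ r s, b j r s ≠ 0 := by
      by_contra! h0
      exact hb0 j (Matrix.ext h0)
    -- A Kronecker product has as entries all products of an entry of `a i` with an entry of `b j`.
    exact mul_ne_zero hrs hrs' (congrFun (congrFun h' (r, r')) (s, s'))
  refine ⟨(Algebra.TensorProduct.lift φ ψ hc).comp ρ.symm.toAlgHom,
    fun k => ρ (t (finProdFinEquiv.symm k)), ?_, ?_, ?_, ?_⟩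
  · rw [range_comp_algEquiv, tensorProduct_lift_range]
  · exact CompleteOrthogonalIdempotents.map ρ.toAlgHom.toRingHom
      ((CompleteOrthogonalIdempotents.equiv finProdFinEquiv.symm).2 ht)
  · intro k h
    rw [map_eq_zero_iff ρ ρ.injective] at h
    exact ht0 _ h
  · rw [sup_toSubmodule_of_commute G₁ G₂ fun x hx y hy => hcomm x (hG₁ hx) y (hG₂ hy), ← hφ, ← hψ,
      Submodule.span_mul_span]
    congr 1
    ext x
    simp only [Set.mem_range, Set.mem_mul, exists_exists_eq_and]
    constructor
    · rintro ⟨k, rfl⟩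
      exact ⟨(finProdFinEquiv.symm k).1, (finProdFinEquiv.symm k).2, by simp [t]⟩
    · rintro ⟨i, j, rfl⟩
      exact ⟨finProdFinEquiv (i, j), by simp [t]⟩

theorem commute_finset_sup {B : ℕ → Subalgebra F A}
    (hcomm : ∀ i j, i ≠ j → ∀ x ∈ B i, ∀ y ∈ B j, x * y = y * x) (k : ℕ) :
    ∀ x ∈ (Finset.range k).sup B, ∀ y ∈ B k, x * y = y * x := by
  intro x hx y hy
  have hle : (Finset.range k).sup B ≤ Subalgebra.centralizer F (B k : Set A) := by
    refine Finset.sup_le fun i hi z hz => ?_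
    rw [Subalgebra.mem_centralizer_iff]
    exact fun w hw => hcomm k i (Finset.mem_range.1 hi).ne' w hw z hz
  exact ((Subalgebra.mem_centralizer_iff F).1 (hle hx) y hy).symm

theorem IsSplitPair.finset_sup {B C : ℕ → Subalgebra F A} {n : ℕ → ℕ}
    (h : ∀ i, IsSplitPair (B i) (C i) (n i)) (hCB : ∀ i, C i ≤ B i)
    (hcomm : ∀ i j, i ≠ j → ∀ x ∈ B i, ∀ y ∈ B j, x * y = y * x) (k : ℕ) :
    IsSplitPair ((Finset.range k).sup B) ((Finset.range k).sup C)
      (∏ i ∈ Finset.range k, n i) := by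
  induction k with
  | zero => simpa using isSplitPair_bot
  | succ k ih =>
    rw [Finset.prod_range_succ, Finset.range_add_one, Finset.sup_insert, Finset.sup_insert,
      sup_comm (B k), sup_comm (C k)]
    exact ih.sup (h k) (Finset.sup_mono_fun fun i _ => hCB i) (hCB k) (commute_finset_sup hcomm k)

/-- The finite joins form an increasing chain, so their union is a subalgebra and a finite subset
lies in one stage. -/
theorem exists_subset_finset_sup (C : ℕ → Subalgebra F A) (s : Finset A)
    (hs : (s : Set A) ⊆ (⨆ i, C i : Subalgebra F A)) :
    ∃ k, (s : Set A) ⊆ ((Finset.range k).sup C : Subalgebra F A) := by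
  have hmono : Monotone fun k => (Finset.range k).sup C := fun k l hkl =>
    Finset.sup_mono (Finset.range_mono hkl)
  have hle : ⨆ i, C i ≤ ⨆ k, (Finset.range k).sup C := iSup_le fun i =>
    le_trans (Finset.le_sup (f := C) (Finset.self_mem_range_succ i))
      (le_iSup (fun k => (Finset.range k).sup C) (i + 1))
  have hcov : (s : Set A) ⊆ ⋃ k, ((Finset.range k).sup C : Subalgebra F A) := by
    rw [← Subalgebra.coe_iSup_of_directed hmono.directed_le]
    exact hs.trans hle
  exact DirectedOn.exists_mem_subset_of_finset_subset_biUnion (c := Set.univ)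
    (f := fun k => ((Finset.range k).sup C : Subalgebra F A).carrier) Set.univ_nonempty
    (fun i _ j _ => ⟨max i j, trivial, hmono (le_max_left _ _), hmono (le_max_right _ _)⟩)
    (by simpa using hcov) |>.imp fun k hk => hk.2

/-! ### The idempotents of a Cartan subalgebra -/

/-- The embedding of the two element field as idempotents of `F`. -/
def idempotentOfZMod (F : Type*) [Field F] (t : ZMod 2) : F := if t = 1 then 1 else 0

theorem idempotentOfZMod_mul (s t : ZMod 2) :
    idempotentOfZMod F (s * t) = idempotentOfZMod F s * idempotentOfZMod F t := by
  unfold idempotentOfZMod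
  rcases zmod_two_eq_zero_or_one s with rfl | rfl <;>
    rcases zmod_two_eq_zero_or_one t with rfl | rfl <;> simp

theorem idempotentOfZMod_add (s t : ZMod 2) :
    idempotentOfZMod F (s + t) = idempotentOfZMod F s + idempotentOfZMod F t -
      2 * (idempotentOfZMod F s * idempotentOfZMod F t) := by
  unfold idempotentOfZMod
  have h : (1 + 1 : ZMod 2) = 0 := rfl
  rcases zmod_two_eq_zero_or_one s with rfl | rfl <;>
    rcases zmod_two_eq_zero_or_one t with rfl | rfl <;> simp [h]
  norm_num

/-- The algebra homomorphism defined by a complete family of orthogonal idempotents. -/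
def sumSmulIdempotents {N : ℕ} {e : Fin N → A} (he : CompleteOrthogonalIdempotents e) :
    (Fin N → F) →ₐ[F] A :=
  AlgHom.ofLinearMap (Fintype.linearCombination F e)
    (by simpa [Fintype.linearCombination_apply] using he.complete) fun x y => by
    simp only [Fintype.linearCombination_apply, Finset.sum_mul_sum, smul_mul_smul_comm, he.mul_eq]
    simp

theorem sumSmulIdempotents_apply {N : ℕ} {e : Fin N → A} (he : CompleteOrthogonalIdempotents e)
    (x : Fin N → F) : sumSmulIdempotents he x = ∑ i, x i • e i := rfl

theorem sumSmulIdempotents_add {N : ℕ} {e : Fin N → A} (he : CompleteOrthogonalIdempotents e)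
    (x y : Fin N → ZMod 2) :
    sumSmulIdempotents (F := F) he (fun i => idempotentOfZMod F (x i + y i)) =
      sumSmulIdempotents (F := F) he (fun i => idempotentOfZMod F (x i)) +
      sumSmulIdempotents (F := F) he (fun i => idempotentOfZMod F (y i)) -
      2 * (sumSmulIdempotents (F := F) he (fun i => idempotentOfZMod F (x i)) *
        sumSmulIdempotents (F := F) he (fun i => idempotentOfZMod F (y i))) := by
  rw [← map_mul, ← map_add, two_mul, ← map_add, ← map_sub, ← two_mul]
  congr 1
  funext i
  exact idempotentOfZMod_add _ _

/-- The homomorphism from a standard Hamming space defined by a complete family of orthogonal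
idempotents. -/
def stdToIdempotents {H : Subalgebra F A} [IsMulCommutative H] {N : ℕ} {e : Fin N → A}
    (he : CompleteOrthogonalIdempotents e) (heH : ∀ i, e i ∈ H) :
    (Fin N → ZMod 2) →+* Idempotents H where
  toFun x := ⟨sumSmulIdempotents (F := F) he fun i => idempotentOfZMod F (x i),
    by
      rw [sumSmulIdempotents_apply]
      exact H.sum_mem fun i _ => H.smul_mem (heH i) _, by
      rw [← map_mul]
      congr 1
      funext i
      rw [Pi.mul_apply, ← idempotentOfZMod_mul]
      congr 1
      rcases zmod_two_eq_zero_or_one (x i) with h | h <;> simp [h]⟩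
  map_one' := Idempotents.ext' (by
    rw [Idempotents.val_one, ← map_one (sumSmulIdempotents (F := F) he)]
    rfl)
  map_mul' x y := Idempotents.ext' ((congrArg _ (funext fun i => idempotentOfZMod_mul (x i) (y i))).trans
      (map_mul (sumSmulIdempotents (F := F) he) (fun i => idempotentOfZMod F (x i))
        fun i => idempotentOfZMod F (y i)))
  map_zero' := Idempotents.ext' (by
    rw [Idempotents.val_zero, ← map_zero (sumSmulIdempotents (F := F) he)]
    rfl)
  map_add' x y := Idempotents.ext' (sumSmulIdempotents_add he x y)

/-- Each of the N idempotents is a nonzero N × N matrix, hence has relative rank at least 1/N; as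
they sum to 1, `rank_map_of_le` forces equality. An idempotent of `G` is a combination of them with
idempotent coefficients, which are 0 or 1 in a field. -/
theorem IsSplitPair.exists_std [IsLocallyMatrixAlgebra F A] {D G H : Subalgebra F A}
    [IsMulCommutative H] {N : ℕ} [NeZero N] (h : IsSplitPair D G N) (hGH : G ≤ H) :
    ∃ φ : (Fin N → ZMod 2) →+* Idempotents H,
      (∀ x, HammingSpace.rank (φ x) = HammingSpace.rank x) ∧
      ∀ e : Idempotents H, e.1 ∈ G → e ∈ Set.range φ := by
  have := IsLocallyMatrixAlgebra.nontrivial (F := F) (A := A)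
  classical
  obtain ⟨φ, a, -, ha, ha0, hG⟩ := h
  have hN : 0 < N := Nat.pos_of_ne_zero (NeZero.ne N)
  have hφ := matrix_algHom_injective hN φ
  have he : CompleteOrthogonalIdempotents fun i => φ (a i) := ha.map φ.toRingHom
  have heG : ∀ i, φ (a i) ∈ G := fun i => by
    rw [← Subalgebra.mem_toSubmodule, ← hG]
    exact Submodule.subset_span ⟨i, rfl⟩
  have he0 : ∀ i, φ (a i) ≠ 0 := fun i h => ha0 i (hφ (h.trans (map_zero φ).symm))
  refine ⟨stdToIdempotents he fun i => hGH (heG i), rank_map_of_le _ fun i => ?_, fun x hx => ?_⟩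
  · have hval : (stdToIdempotents he (fun i => hGH (heG i)) (Pi.single i 1)).1 = φ (a i) := by
      refine (sumSmulIdempotents_apply he _).trans ?_
      rw [Finset.sum_eq_single i]
      · simp [idempotentOfZMod]
      · intro j _ hj
        simp [idempotentOfZMod, hj]
      · simp
    change _ ≤ relRank F _
    have hmem : φ (a i) ∈ φ.range := ⟨a i, rfl⟩
    rw [hval, relRank_eq hmem hN (AlgEquiv.ofInjective φ hφ).symm]
    have hs : (AlgEquiv.ofInjective φ hφ).symm ⟨φ (a i), hmem⟩ = a i :=
      (AlgEquiv.ofInjective φ hφ).symm_apply_apply (a i)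
    rw [hs]
    have : 1 ≤ (a i).rank := Nat.one_le_iff_ne_zero.2 fun h => ha0 i ((matrix_rank_eq_zero _).1 h)
    gcongr
    exact_mod_cast this
  · rw [← Subalgebra.mem_toSubmodule, ← hG, Submodule.mem_span_range_iff_exists_fun] at hx
    obtain ⟨c, hc⟩ := hx
    -- By orthogonality, multiplication by the i-th idempotent isolates the i-th coefficient.
    have hmul : ∀ i, x.1 * φ (a i) = c i • φ (a i) := fun i => by
      rw [← hc, Finset.sum_mul, Finset.sum_eq_single i]
      · rw [smul_mul_assoc, he.idem]
      · intro j _ hj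
        rw [smul_mul_assoc, he.ortho hj, smul_zero]
      · simp
    have hcc : ∀ i, c i * c i = c i := fun i => by
      have h1 : (c i * c i - c i) • φ (a i) = 0 := by
        rw [sub_smul, mul_smul, ← hmul, ← mul_smul_comm, ← hmul, ← mul_assoc, x.2.2, sub_self]
      exact sub_eq_zero.1 ((smul_eq_zero.1 h1).resolve_right (he0 i))
    refine ⟨fun i => if c i = 0 then 0 else 1, Idempotents.ext' ?_⟩
    rw [← hc]
    refine (sumSmulIdempotents_apply he _).trans (Finset.sum_congr rfl fun i _ => ?_)
    congr 1
    by_cases h0 : c i = 0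
    · simp [idempotentOfZMod, h0]
    · simp only [h0, if_false, idempotentOfZMod, if_true]
      exact (mul_left_cancel₀ h0 ((hcc i).trans (mul_one _).symm)).symm

/-- The bridge between the two theories: the same partial products n_0 ... n_{k-1} are sizes of
standard spaces exhausting E(H) and of matrix algebras exhausting A. -/
theorem isLocallyStandard_idempotents [IsLocallyMatrixAlgebra F A] (H : Subalgebra F A)
    [hH : IsCartanSubalgebra H] :
    Countable (Idempotents H) ∧ IsLocallyStandard (Idempotents H) ∧
      hammingSt (Idempotents H) = algebraSt F A := by
  classical
  have := IsLocallyMatrixAlgebra.nontrivial (F := F) (A := A)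
  obtain ⟨n, B, C, hB, hBn, hC, hHC⟩ := hH.exists_decomposition
  have hsplit : ∀ i, IsSplitPair (B i) (C i) (n i) := fun i =>
    let ⟨e⟩ := (hBn i).2
    let ⟨g⟩ := (hC i).2
    isSplitPair_of_algEquiv (hC i).1 e g
  have hpair := IsSplitPair.finset_sup hsplit (fun i => (hC i).1) hB.commute
  have hN : ∀ k, NeZero (∏ i ∈ Finset.range k, n i) := fun k =>
    ⟨Finset.prod_ne_zero_iff.2 fun i _ => (hBn i).1.ne'⟩
  have hle : ∀ k, (Finset.range k).sup C ≤ H := fun k => by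
    rw [hHC]
    exact Finset.sup_le fun i _ => le_iSup C i
  choose Θ hΘ hΘs using fun k => (hpair k).exists_std (hle k)
  have hcov : ∀ s : Finset (Idempotents H), ∃ k, (s : Set (Idempotents H)) ⊆ Set.range (Θ k) := by
    intro s
    obtain ⟨k, hk⟩ := exists_subset_finset_sup C (s.image Subtype.val) (by
      intro x hx
      obtain ⟨e, -, rfl⟩ := Finset.mem_image.1 (Finset.mem_coe.1 hx)
      rw [← hHC]
      exact e.2.1)
    exact ⟨k, fun e he => hΘs k e (hk (Finset.mem_coe.2 (Finset.mem_image_of_mem _ he)))⟩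
  refine ⟨countable_of_exhaustion (fun k => Θ k) hcov,
    isLocallyStandard_of_exhaustion Θ hΘ hcov, ?_⟩
  choose φ a hφ _ _ _ using hpair
  rw [hammingSt_eq_of_exhaustion Θ hΘ hcov, algebraSt_eq_of_exhaustion
    (fun k => Nat.pos_of_ne_zero (hN k).out) φ fun s => ?_]
  obtain ⟨k, hk⟩ := exists_subset_finset_sup B s (by rw [hB.iSup_eq_top]; exact fun _ _ => trivial)
  exact ⟨k, by rwa [hφ]⟩

end SplitPairs

/-! ### Infinite tensor products of matrix algebras -/

section TensorProducts

variable {F : Type*} [Field F] {A : Type*} [Ring A] [Algebra F A]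

theorem finset_sup_toSubmodule_le_span {B : ℕ → Subalgebra F A}
    (hcomm : ∀ i j, i ≠ j → ∀ x ∈ B i, ∀ y ∈ B j, x * y = y * x) (k : ℕ) :
    Subalgebra.toSubmodule ((Finset.range k).sup B) ≤
      Submodule.span F {z | ∃ x : Fin k → A, (∀ i : Fin k, x i ∈ B (i : ℕ)) ∧ z = (List.ofFn x).prod} := by
  induction k with
  | zero =>
    rw [Finset.range_zero, Finset.sup_empty, Algebra.toSubmodule_bot, Submodule.one_eq_span]
    refine Submodule.span_mono ?_
    rintro _ rfl
    exact ⟨Fin.elim0, fun i => i.elim0, by simp⟩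
  | succ k ih =>
    rw [Finset.range_add_one, Finset.sup_insert, sup_comm,
      sup_toSubmodule_of_commute _ _ (commute_finset_sup hcomm k), Submodule.mul_le]
    intro x hx y hy
    have hx' := ih hx
    clear hx
    induction hx' using Submodule.span_induction with
    | mem x h =>
      obtain ⟨f, hf, rfl⟩ := h
      refine Submodule.subset_span ⟨Fin.snoc f y, fun i => ?_, ?_⟩
      · refine Fin.lastCases ?_ (fun j => ?_) i
        · simpa using hy
        · simpa using hf j
      · rw [List.ofFn_succ']
        simp
    | zero => rw [zero_mul]; exact Submodule.zero_mem _
    | add x x' _ _ h h' => rw [add_mul]; exact Submodule.add_mem _ h h'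
    | smul c x _ h => rw [smul_mul_assoc]; exact Submodule.smul_mem _ c h

theorem IsSplitPair.finrank_eq [Nontrivial A] {D G : Subalgebra F A} {N : ℕ} (hN : 0 < N)
    (h : IsSplitPair D G N) : Module.Finite F D ∧ Module.finrank F D = N * N := by
  obtain ⟨φ, -, rfl, -⟩ := h
  let e := (AlgEquiv.ofInjective φ (matrix_algHom_injective hN φ)).toLinearEquiv
  exact ⟨Module.Finite.equiv e, by rw [← e.finrank_eq, Module.finrank_matrix]; simp⟩

/-- Independence of commuting matrix subalgebras is a dimension count. The tensor product of the
first k factors has dimension (n_0 ... n_{k-1})², and the range of multiplication contains the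
generated algebra, which is a matrix algebra of that same dimension; so the kernel vanishes. -/
theorem isInternalTensorProduct_of_commute [Nontrivial A] {B C : ℕ → Subalgebra F A} {n : ℕ → ℕ}
    (hn : ∀ i, 0 < n i) (h : ∀ i, IsSplitPair (B i) (C i) (n i)) (hCB : ∀ i, C i ≤ B i)
    (hcomm : ∀ i j, i ≠ j → ∀ x ∈ B i, ∀ y ∈ B j, x * y = y * x) (htop : ⨆ i, B i = ⊤) :
    IsInternalTensorProduct B where
  commute := hcomm
  iSup_eq_top := htop
  injective k := by
    set L := PiTensorProduct.lift ((MultilinearMap.mkPiAlgebraFin F k A).compLinearMap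
      fun i : Fin k => (B (i : ℕ)).val.toLinearMap) with hL
    have hfin : ∀ i, Module.Finite F (B i) := fun i => ((h i).finrank_eq (hn i)).1
    let b := Basis.piTensorProduct fun i : Fin k => Module.finBasis F (B (i : ℕ))
    have hfinT : Module.Finite F (PiTensorProduct F fun i : Fin k => B (i : ℕ)) :=
      Module.Finite.of_basis b
    have hdim : Module.finrank F (PiTensorProduct F fun i : Fin k => B (i : ℕ)) =
        (∏ i ∈ Finset.range k, n i) * ∏ i ∈ Finset.range k, n i := by
      rw [Module.finrank_eq_card_basis b, Fintype.card_pi, ← Finset.prod_mul_distrib,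
        Finset.prod_range]
      exact Finset.prod_congr rfl fun i _ => by
        rw [Fintype.card_fin, ((h i).finrank_eq (hn i)).2]
    have hle : Subalgebra.toSubmodule ((Finset.range k).sup B) ≤ LinearMap.range L := by
      refine (finset_sup_toSubmodule_le_span hcomm k).trans (Submodule.span_le.2 ?_)
      rintro _ ⟨x, hx, rfl⟩
      refine ⟨PiTensorProduct.tprod F fun i => ⟨x i, hx i⟩, ?_⟩
      rw [hL, PiTensorProduct.lift.tprod]
      simp
    have hD := (IsSplitPair.finset_sup h hCB hcomm k).finrank_eq
      (Finset.prod_pos fun i _ => hn i)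
    have h1 := Submodule.finrank_mono hle
    have h2 := LinearMap.finrank_range_add_finrank_ker L
    have h3 : Module.finrank F (Subalgebra.toSubmodule ((Finset.range k).sup B)) =
      (∏ i ∈ Finset.range k, n i) * ∏ i ∈ Finset.range k, n i := hD.2
    rw [← LinearMap.ker_eq_bot, ← Submodule.finrank_eq_zero (R := F)]
    omega

theorem isLocallyMatrixAlgebra_of_isSplitPair [Nontrivial A] {B C : ℕ → Subalgebra F A}
    {n : ℕ → ℕ} (hn : ∀ i, 0 < n i) (h : ∀ i, IsSplitPair (B i) (C i) (n i))
    (hCB : ∀ i, C i ≤ B i) (hB : IsInternalTensorProduct B) :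
    IsLocallyMatrixAlgebra F A ∧ Module.rank F A ≤ Cardinal.aleph0 ∧
      algebraSt F A = steinitzLcm (Set.range fun k => ∏ i ∈ Finset.range k, n i) := by
  have hN : ∀ k, 0 < ∏ i ∈ Finset.range k, n i := fun k => Finset.prod_pos fun i _ => hn i
  choose φ a hφ _ _ _ using IsSplitPair.finset_sup h hCB hB.commute
  have hcov : ∀ s : Finset A, ∃ k, (s : Set A) ⊆ (φ k).range := fun s => by
    obtain ⟨k, hk⟩ := exists_subset_finset_sup B s (by
      rw [hB.iSup_eq_top]
      exact fun _ _ => trivial)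
    exact ⟨k, by rwa [hφ]⟩
  refine ⟨⟨fun s => ?_⟩, ?_, algebraSt_eq_of_exhaustion hN φ hcov⟩
  · obtain ⟨k, hk⟩ := hcov s
    exact ⟨(φ k).range, hk, _, hN k,
      ⟨(AlgEquiv.ofInjective (φ k) (matrix_algHom_injective (hN k) (φ k))).symm⟩⟩
  -- The images of the matrix units of all stages form a countable spanning set.
  · let s : Set A := ⋃ k, (matrixUnitsImage (φ k) : Set A)
    have hs : s.Countable := Set.countable_iUnion fun k => (Finset.finite_toSet _).countable
    have htop : Submodule.span F s = ⊤ := by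
      rw [eq_top_iff]
      intro x _
      obtain ⟨k, hk⟩ := hcov {x}
      obtain ⟨M, hM⟩ := hk (Finset.mem_coe.2 (Finset.mem_singleton_self x))
      change φ k M = x at hM
      rw [← hM, Matrix.matrix_eq_sum_single M, map_sum]
      refine Submodule.sum_mem _ fun i _ => ?_
      rw [map_sum]
      refine Submodule.sum_mem _ fun j _ => ?_
      have hc : Matrix.single i j (M i j) = M i j • Matrix.single i j (1 : F) := by simp
      rw [hc, map_smul]
      refine Submodule.smul_mem _ _ (Submodule.subset_span (Set.mem_iUnion.2 ⟨k, ?_⟩))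
      simp [matrixUnitsImage]
    rw [← rank_top, ← htop]
    exact (rank_span_le s).trans hs.le_aleph0

/-- The Cartan subalgebra is generated by the images of the diagonal matrices of the factors. -/
theorem exists_cartan_of_commute [Nontrivial A] {q : ℕ → ℕ} (hq : ∀ k, 0 < q k)
    (α : ∀ k, Matrix (Fin (q k)) (Fin (q k)) F →ₐ[F] A)
    (hα : ∀ i j, i ≠ j → ∀ a b, α i a * α j b = α j b * α i a) (htop : ⨆ k, (α k).range = ⊤) :
    ∃ (_ : IsLocallyMatrixAlgebra F A) (H : Subalgebra F A) (_ : IsCartanSubalgebra H),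
      Module.rank F A ≤ Cardinal.aleph0 ∧
      algebraSt F A = steinitzLcm (Set.range fun k => ∏ i ∈ Finset.range k, q i) := by
  let B := fun k => (α k).range
  let δ : ∀ k, (Fin (q k) → F) →ₐ[F] A := fun k => (α k).comp (Matrix.diagonalAlgHom F)
  let C := fun k => (δ k).range
  have hCB : ∀ k, C k ≤ B k := fun k => AlgHom.range_comp_le_range _ _
  have hinj : ∀ k, Function.Injective (α k) := fun k => matrix_algHom_injective (hq k) (α k)
  have hinj' : ∀ k, Function.Injective (δ k) := fun k => (hinj k).comp Matrix.diagonal_injective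
  have hcomm : ∀ i j, i ≠ j → ∀ x ∈ B i, ∀ y ∈ B j, x * y = y * x := by
    rintro i j hij _ ⟨a, rfl⟩ _ ⟨b, rfl⟩
    exact hα i j hij a b
  let eB := fun k => (AlgEquiv.ofInjective _ (hinj k)).symm
  let eC := fun k => (AlgEquiv.ofInjective _ (hinj' k)).symm
  have hsplit : ∀ k, IsSplitPair (B k) (C k) (q k) := fun k =>
    isSplitPair_of_algEquiv (hCB k) (eB k) (eC k)
  have hB := isInternalTensorProduct_of_commute hq hsplit hCB hcomm htop
  obtain ⟨hA, hrank, hst⟩ := isLocallyMatrixAlgebra_of_isSplitPair hq hsplit hCB hB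
  exact ⟨hA, ⨆ k, C k,
    ⟨q, B, C, hB, fun k => ⟨hq k, ⟨eB k⟩⟩, fun k => ⟨hCB k, ⟨eC k⟩⟩, rfl⟩, hrank, hst⟩

/-! ### Realization of prescribed Steinitz numbers. -/

/-- A homomorphism as one into the subalgebra generated by the ranges of a family containing it. -/
def rangeFactor {ι : Type*} {R : ι → Type*} [∀ k, Semiring (R k)] [∀ k, Algebra F (R k)]
    (α : ∀ k, R k →ₐ[F] A) (k : ι) : R k →ₐ[F] (⨆ k, (α k).range : Subalgebra F A) :=
  (α k).codRestrict _ fun a => le_iSup (fun k => (α k).range) k ⟨a, rfl⟩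

theorem iSup_range_rangeFactor {ι : Type*} {R : ι → Type*} [∀ k, Semiring (R k)]
    [∀ k, Algebra F (R k)] (α : ∀ k, R k →ₐ[F] A) : ⨆ k, (rangeFactor α k).range = ⊤ := by
  have hle : ⨆ k, (α k).range ≤
      (⨆ k, (rangeFactor α k).range).map (⨆ k, (α k).range : Subalgebra F A).val := by
    refine iSup_le fun k => ?_
    rintro _ ⟨a, rfl⟩
    exact ⟨rangeFactor α k a, le_iSup (fun k => (rangeFactor α k).range) k ⟨a, rfl⟩, rfl⟩
  rw [eq_top_iff]
  rintro ⟨x, hx⟩ -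
  obtain ⟨y, hy, rfl⟩ := hle hx
  exact hy

/-- The ambient ring may be far too large; the subalgebra generated by the commuting copies is the
algebra wanted. -/
theorem exists_cartan_of_commuting_family {F R : Type u} [Field F] [Ring R] [Algebra F R]
    [Nontrivial R] {q : ℕ → ℕ} (hq : ∀ k, 0 < q k)
    (α : ∀ k, Matrix (Fin (q k)) (Fin (q k)) F →ₐ[F] R)
    (hα : ∀ i j, i ≠ j → ∀ a b, α i a * α j b = α j b * α i a) :
    ∃ (A : Type u) (_ : Ring A) (_ : Algebra F A) (_ : IsLocallyMatrixAlgebra F A)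
      (H : Subalgebra F A) (_ : IsCartanSubalgebra H), Module.rank F A ≤ Cardinal.aleph0 ∧
      algebraSt F A = steinitzLcm (Set.range fun k => ∏ i ∈ Finset.range k, q i) := by
  obtain ⟨hA, H, hH, h⟩ := exists_cartan_of_commute hq (rangeFactor α)
    (fun i j hij a b => Subtype.ext (hα i j hij a b)) (iSup_range_rangeFactor α)
  exact ⟨_, _, _, hA, H, hH, h⟩

/-- The action of `q k × q k` matrices on functions of a sequence through its `k`-th entry. -/
def coordAction (F : Type*) [Field F] (q : ℕ → ℕ) (k : ℕ) :
    Matrix (Fin (q k)) (Fin (q k)) F →ₐ[F] Module.End F ((∀ i, Fin (q i)) → F) where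
  toFun a :=
    { toFun := fun v x => ∑ j, a (x k) j * v (Function.update x k j)
      map_add' := fun v w => by
        funext x
        simp [mul_add, Finset.sum_add_distrib]
      map_smul' := fun c v => by
        funext x
        simp [Finset.mul_sum, mul_left_comm] }
  map_one' := by
    refine LinearMap.ext fun v => funext fun x => ?_
    simp [Matrix.one_apply]
  map_mul' a b := by
    refine LinearMap.ext fun v => funext fun x => ?_
    simp only [LinearMap.coe_mk, AddHom.coe_mk, Matrix.mul_apply, Module.End.mul_apply,
      Function.update_self, Function.update_idem, Finset.sum_mul, Finset.mul_sum]
    rw [Finset.sum_comm]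
    simp only [mul_assoc]
  map_zero' := by
    refine LinearMap.ext fun v => funext fun x => ?_
    simp
  map_add' a b := by
    refine LinearMap.ext fun v => funext fun x => ?_
    simp [add_mul, Finset.sum_add_distrib]
  commutes' c := by
    refine LinearMap.ext fun v => funext fun x => ?_
    simp [Matrix.algebraMap_matrix_apply, Module.algebraMap_end_apply]

theorem coordAction_apply (q : ℕ → ℕ) (k : ℕ) (a : Matrix (Fin (q k)) (Fin (q k)) F)
    (v : (∀ i, Fin (q i)) → F) (x : ∀ i, Fin (q i)) :
    coordAction F q k a v x = ∑ j, a (x k) j * v (Function.update x k j) := rfl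

theorem coordAction_commute (q : ℕ → ℕ) {k l : ℕ} (hkl : k ≠ l)
    (a : Matrix (Fin (q k)) (Fin (q k)) F) (b : Matrix (Fin (q l)) (Fin (q l)) F) :
    coordAction F q k a * coordAction F q l b = coordAction F q l b * coordAction F q k a := by
  refine LinearMap.ext fun v => funext fun x => ?_
  simp only [Module.End.mul_apply, coordAction_apply, Finset.mul_sum,
    Function.update_of_ne hkl, Function.update_of_ne hkl.symm]
  rw [Finset.sum_comm]
  refine Finset.sum_congr rfl fun i _ => Finset.sum_congr rfl fun j _ => ?_
  rw [Function.update_comm hkl, mul_left_comm]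

theorem exists_cartan_of_sequence (F : Type u) [Field F] (q : ℕ → ℕ) (hq : ∀ k, 0 < q k) :
    ∃ (A : Type u) (_ : Ring A) (_ : Algebra F A) (_ : IsLocallyMatrixAlgebra F A)
      (H : Subalgebra F A) (_ : IsCartanSubalgebra H), Module.rank F A ≤ Cardinal.aleph0 ∧
      algebraSt F A = steinitzLcm (Set.range fun k => ∏ i ∈ Finset.range k, q i) := by
  -- Sequences then exist, so the space of functions on them, and with it the endomorphism algebra,
  -- is nontrivial.
  have : ∀ k, Nonempty (Fin (q k)) := fun k => ⟨⟨0, hq k⟩⟩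
  exact exists_cartan_of_commuting_family hq (coordAction F q) fun _ _ hij a b =>
    coordAction_commute q hij a b

/-- Each set of positive integers has the same least common multiple as the partial products of
some sequence. -/
theorem exists_sequence_steinitzLcm (D : Set ℕ) (hD : ∀ n ∈ D, 0 < n) :
    ∃ q : ℕ → ℕ, (∀ k, 0 < q k) ∧
      steinitzLcm (Set.range fun k => ∏ i ∈ Finset.range k, q i) = steinitzLcm D := by
  classical
  -- `N k` is the least common multiple of the members of `D` below k, with 1 as a neutral filler.
  -- The sequence consists of the quotients of consecutive `N k`, whose product telescopes because
  -- `N 0 = 1`.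
  let d : ℕ → ℕ := fun i => if i ∈ D then i else 1
  let N : ℕ → ℕ := fun k => (Finset.range k).lcm d
  have hd : ∀ i, d i ≠ 0 := fun i => by
    by_cases h : i ∈ D
    · simpa [d, h] using (hD i h).ne'
    · simp [d, h]
  have hN : ∀ k, N k ≠ 0 := fun k => by
    simp only [N, ne_eq, Finset.lcm_eq_zero_iff, not_exists, not_and]
    exact fun i _ => hd i
  have hsucc : ∀ k, N (k + 1) = Nat.lcm (d k) (N k) := fun k => by
    simp only [N, Finset.range_add_one, Finset.lcm_insert]
    rfl
  have hdvd : ∀ k, N k ∣ N (k + 1) := fun k => by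
    rw [hsucc]
    exact Nat.dvd_lcm_right _ _
  have hprod : ∀ k, ∏ i ∈ Finset.range k, N (i + 1) / N i = N k := fun k => by
    induction k with
    | zero => simp [N]
    | succ k ih => rw [Finset.prod_range_succ, ih, Nat.mul_div_cancel' (hdvd k)]
  refine ⟨fun k => N (k + 1) / N k, fun k => Nat.div_pos
    (Nat.le_of_dvd (Nat.pos_of_ne_zero (hN _)) (hdvd k)) (Nat.pos_of_ne_zero (hN k)), ?_⟩
  simp only [hprod]
  refine funext fun p => le_antisymm (iSup₂_le ?_) (steinitzLcm_le_of_dvd (fun n hn => ?_) p)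
  · rintro _ ⟨k, rfl⟩
    dsimp only
    induction k with
    | zero => simp [N]
    | succ k ih =>
      -- The exponent in a least common multiple is the larger of the two, so it comes either from
      -- the earlier stage or from `d k`.
      rw [hsucc, Nat.factorization_lcm (hd k) (hN k), Finsupp.sup_apply]
      rcases le_total ((N k).factorization (p : ℕ)) ((d k).factorization (p : ℕ)) with hle | hle
      swap
      · rwa [sup_eq_right.2 hle]
      rw [sup_eq_left.2 hle]
      by_cases h : k ∈ D
      · simp only [d, h, if_true]
        exact le_steinitzLcm h p
      · simp [d, h]
  · refine ⟨N (n + 1), ⟨n + 1, rfl⟩, hN _, ?_⟩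
    rw [hsucc]
    simp only [d, hn, if_true]
    exact Nat.dvd_lcm_left _ _

end TensorProducts

theorem theorem4 (F : Type u) [Field F] [IsAlgClosed F] :
    (∀ (S : Type v) [BooleanRing S] [HammingSpace S], Countable S → IsLocallyStandard S →
      ∃ (A : Type u) (_ : Ring A) (_ : Algebra F A) (_ : IsLocallyMatrixAlgebra F A)
        (H : Subalgebra F A) (_ : IsCartanSubalgebra H),
        Module.rank F A ≤ Cardinal.aleph0 ∧
        Nonempty (HammingIso S (Idempotents H)) ∧
        hammingSt S = algebraSt F A) ∧
    (∀ (A₁ : Type w₁) [Ring A₁] [Algebra F A₁] [IsLocallyMatrixAlgebra F A₁]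
      (A₂ : Type w₂) [Ring A₂] [Algebra F A₂] [IsLocallyMatrixAlgebra F A₂],
      Module.rank F A₁ ≤ Cardinal.aleph0 → Module.rank F A₂ ≤ Cardinal.aleph0 →
      ∀ (H₁ : Subalgebra F A₁) [IsCartanSubalgebra H₁]
        (H₂ : Subalgebra F A₂) [IsCartanSubalgebra H₂],
        Nonempty (HammingIso (Idempotents H₁) (Idempotents H₂)) ↔
          Nonempty (A₁ ≃ₐ[F] A₂)) := by
  refine ⟨fun S _ _ hS hstd => ?_, fun A₁ _ _ _ A₂ _ _ _ h₁ h₂ H₁ _ H₂ _ => ?_⟩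
  -- The set is the one defining `hammingSt S`, so the algebra built from `q` has the Steinitz
  -- number of `S`; by the bridge E(H) has it too, and the classification of Hamming spaces applies.
  · obtain ⟨q, hq, hqD⟩ := exists_sequence_steinitzLcm
      {n : ℕ | ∃ _ : NeZero n, ∃ T : Subring S, Nonempty (HammingIso T (Fin n → ZMod 2))}
      fun n ⟨hn, _⟩ => Nat.pos_of_ne_zero hn.out
    obtain ⟨A, _, _, hA, H, hH, hrank, hst⟩ := exists_cartan_of_sequence F q hq
    have hSA : hammingSt S = algebraSt F A := (hst.trans hqD).symm
    obtain ⟨hc, hE, hEst⟩ := isLocallyStandard_idempotents H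
    exact ⟨A, _, _, hA, H, hH, hrank,
      nonempty_hammingIso_of_hammingSt_eq hstd hE (hSA.trans hEst.symm), hSA⟩
  · obtain ⟨hc₁, hE₁, hst₁⟩ := isLocallyStandard_idempotents H₁
    obtain ⟨hc₂, hE₂, hst₂⟩ := isLocallyStandard_idempotents H₂
    have := IsLocallyMatrixAlgebra.nontrivial (F := F) (A := A₁)
    have := IsLocallyMatrixAlgebra.nontrivial (F := F) (A := A₂)
    constructor
    · rintro ⟨e⟩
      exact nonempty_algEquiv_of_algebraSt_eq h₁ h₂
        (hst₁.symm.trans ((hammingSt_eq_of_hammingIso e).trans hst₂))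
    · rintro ⟨e⟩
      exact nonempty_hammingIso_of_hammingSt_eq hE₁ hE₂
        (hst₁.trans ((algebraSt_eq_of_algEquiv e).trans hst₂.symm))
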